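/- Let $\mathbb G$ be a connected undirected graph on agents $1,\dots,m$, and let $\mathcal N_i$ be the set of neighbors of $i$. For each $i$ let $f_i:\mathbb R^n\to\mathbb R$ be convex and continuously differentiable with (globally) Lipschitz gradient, let $A_i\in\mathbb R^{n_i\times n}$ and $b_i\in\mathbb R^{n_i}$, and let $P_i$ be the orthogonal projection of $\mathbb R^n$ onto $\ker A_i$. Assume that the problem $$\text{minimize } \sum_{i=1}^m f_i(x_i)\quad\text{subject to } A_ix_i=b_i\ (i=1,\dots,m),\quad x_1=\dots=x_m$$ has a (possibly non-unique) solution; a point $x^*\in\mathbb R^n$ is called optimal if $x_1=\dots=x_m=x^*$ is a solution. Consider on $[0,\infty)$ the dynamics $$\dot x_i(t)=-P_i\Big(\nabla f_i(x_i(t))+\sum_{j\in\mathcal N_i}(x_i(t)-x_j(t))+y_i(t)\Big),\qquad y_i(t)=\int_0^t\sum_{j\in\mathcal N_i}(x_i(s)-x_j(s))\,ds,$$ with initial states satisfying $A_ix_i(0)=b_i$ for all $i$. Then every such initial state admits a solution on $[0,\infty)$, and for every solution there is an optimal point $x^*$ with $x_i(t)\to x^*$ as $t\to\infty$ for all $i$.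 If, in addition, $x^*$ is the unique optimal point and $F=\sum_{i=1}^m f_i$ is strongly convex at $x^*$, i.e. there is $\omega>0$ with $a^\top[\nabla F(a+x^*)-\nabla F(x^*)]\ge\omega\|a\|^2$ for all $a\in\mathbb R^n$, then the convergence is globally exponential: there are constants $C,r>0$, independent of the initial states, such that for every solution the full-state error $$e(t)=\sum_{i=1}^m\Big(\|x_i(t)-x^*\|+\|P_i(y_i(t)+\nabla f_i(x^*))\|\Big)$$ satisfies $e(t)\le C\,e(0)\,e^{-rt}$ for all $t\ge 0$. In particular, since $y_i(0)=0$, $$\sum_{i=1}^m\|x_i(t)-x^*\|\le C\,e^{-rt}\sum_{i=1}^m\big(\|x_i(0)-x^*\|+\|P_i\nabla f_i(x^*)\|\big).$$ -/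

import Mathlib

open scoped BigOperators

namespace IntegralFeedback

noncomputable section

/-- The tuple `z` of local variables satisfies the local linear constraints `A i (z i) = b i`
and the consensus constraint. -/
def Feasible {ι : Type*} {n : ℕ} {k : ι → ℕ}
    (A : (i : ι) → Matrix (Fin (k i)) (Fin n) ℝ) (b : (i : ι) → EuclideanSpace ℝ (Fin (k i)))
    (z : ι → EuclideanSpace ℝ (Fin n)) : Prop :=
  (∀ i, Matrix.toEuclideanLin (A i) (z i) = b i) ∧ ∀ i j, z i = z j

/-- The tuple `z` minimizes `∑ i, f i (z i)` subject to the local linear constraints and the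
consensus constraint. -/
def IsOptimal {ι : Type*} [Fintype ι] {n : ℕ} {k : ι → ℕ}
    (f : ι → EuclideanSpace ℝ (Fin n) → ℝ)
    (A : (i : ι) → Matrix (Fin (k i)) (Fin n) ℝ) (b : (i : ι) → EuclideanSpace ℝ (Fin (k i)))
    (z : ι → EuclideanSpace ℝ (Fin n)) : Prop :=
  Feasible A b z ∧ ∀ w, Feasible A b w → ∑ i, f i (z i) ≤ ∑ i, f i (w i)

/-- The orthogonal projection of `ℝⁿ` onto `ker A`. -/
def kerProj {k n : ℕ} (A : Matrix (Fin k) (Fin n) ℝ) :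
    EuclideanSpace ℝ (Fin n) →L[ℝ] EuclideanSpace ℝ (Fin n) :=
  (LinearMap.ker (Matrix.toEuclideanLin A)).starProjection

/-- The disagreement `∑_{j ∈ N(i)} (z i - z j)` of agent `i` with its neighbours. -/
def disagreement {ι : Type*} [Fintype ι] {n : ℕ} (G : SimpleGraph ι) [DecidableRel G.Adj]
    (z : ι → EuclideanSpace ℝ (Fin n)) (i : ι) : EuclideanSpace ℝ (Fin n) :=
  ∑ j ∈ G.neighborFinset i, (z i - z j)

/-- The integral feedback term `∫₀ᵗ ∑_{j ∈ N(i)} (x i - x j)` of agent `i`. -/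
def integralTerm {ι : Type*} [Fintype ι] {n : ℕ} (G : SimpleGraph ι) [DecidableRel G.Adj]
    (x : ℝ → ι → EuclideanSpace ℝ (Fin n)) (i : ι) (t : ℝ) : EuclideanSpace ℝ (Fin n) :=
  ∫ s in (0 : ℝ)..t, disagreement G (x s) i

/-- `x` is a solution on `[0, ∞)` of the integral-feedback projected dynamics
`ẋ i = -P i (∇ f i (x i) + ∑_{j ∈ N(i)} (x i - x j) + ∫₀ᵗ ∑_{j ∈ N(i)} (x i - x j))`,
with `P i` the orthogonal projection onto `ker (A i)`, whose initial state satisfies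
`A i (x i 0) = b i`. The derivative at `t = 0` is one-sided. -/
def IsTrajectory {ι : Type*} [Fintype ι] {n : ℕ} {k : ι → ℕ}
    (G : SimpleGraph ι) [DecidableRel G.Adj] (f : ι → EuclideanSpace ℝ (Fin n) → ℝ)
    (A : (i : ι) → Matrix (Fin (k i)) (Fin n) ℝ) (b : (i : ι) → EuclideanSpace ℝ (Fin (k i)))
    (x : ℝ → ι → EuclideanSpace ℝ (Fin n)) : Prop :=
  (∀ i, Matrix.toEuclideanLin (A i) (x 0 i) = b i) ∧
  ∀ t : ℝ, 0 ≤ t → ∀ i,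
    HasDerivWithinAt (fun s => x s i)
      (-(kerProj (A i)
        (gradient (f i) (x t i) + disagreement G (x t) i + integralTerm G x i t)))
      (Set.Ici 0) t

/-- Strong convexity of a differentiable function at a point `p`, with some parameter `ω > 0`:
`⟪a, ∇F(a + p) - ∇F(p)⟫ ≥ ω ‖a‖²` for all `a`. -/
def StronglyConvexAt {n : ℕ} (F : EuclideanSpace ℝ (Fin n) → ℝ)
    (p : EuclideanSpace ℝ (Fin n)) : Prop :=
  ∃ ω : ℝ, 0 < ω ∧ ∀ a, ω * ‖a‖ ^ 2 ≤ inner ℝ a (gradient F (a + p) - gradient F p)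

/-- The distance at time `t` of the full closed-loop state, consisting of the agents' states
`x i` and the projected integral states `P i (y i)`, `y i = ∫₀ᵗ ∑_{j ∈ N(i)} (x i - x j)`, from
the equilibrium `x i = p`, `P i (y i) = -P i (∇ f i p)`. -/
def stateError {ι : Type*} [Fintype ι] {n : ℕ} {k : ι → ℕ}
    (G : SimpleGraph ι) [DecidableRel G.Adj] (f : ι → EuclideanSpace ℝ (Fin n) → ℝ)
    (A : (i : ι) → Matrix (Fin (k i)) (Fin n) ℝ)
    (p : EuclideanSpace ℝ (Fin n)) (x : ℝ → ι → EuclideanSpace ℝ (Fin n)) (t : ℝ) : ℝ :=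
  ∑ i, (‖x t i - p‖ + ‖kerProj (A i) (integralTerm G x i t + gradient (f i) p)‖)

end

end IntegralFeedback

/-! Fix an optimal point `p`, stack the errors `u = x - p`, and let `P`, `L` be the blockwise
projection and the graph Laplacian. Feasibility gives `P u = u`. Put `M = P L P` and `g u = P (∇f (p
+ P u) - ∇f p)`. Since `ker M` consists of vectors whose projection is a consensus vector with value
in every `ker (A i)`, the first-order condition says `P ∇f(p) ⟂ ker M`, so `P ∇f(p) = M w₀` for some
`w₀`. With `w = w₀ + ∫ u` the integral feedback becomes the elastic force `M w`, and the dynamics is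
a damped oscillator `w' = u`, `u' = -(g u + M u + M w)` (`IsTrajectory.exists_isDampedTrajectory`).

Convex functions with Lipschitz gradient have cocoercive gradients, hence `g` is cocoercive and `½‖u
- a‖² + ½⟪w, M w⟫` decreases for every equilibrium velocity `a`. Barbalat's lemma sends the
dissipation to zero, so `g u → 0` and `M u → 0`; boundedness of `u` then forces `M w → 0`. A cluster
point `a` of `u` is an equilibrium, and the energy centred at `a` is monotone and vanishes along a
subsequence, so `u → a`. Equilibria satisfy the first-order conditions, so `p + a` is optimal.

For the rate, strong convexity of the sum is strong monotonicity on consensus vectors only; the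
Laplacian controls the distance to these, and together they make the dissipation at least `α‖u‖²`.
Adding a small multiple of `⟪u, M w⟫` to the energy gives a strict Lyapunov function comparable with
`‖u‖² + ‖M w‖²`. Existence follows from Lipschitz dependence in the joint state `(x, y)`. -/

namespace IntegralFeedback

/-! ### Global existence for autonomous Lipschitz equations -/

open Set in
/-- Concatenation of two solutions of an autonomous differential equation. -/
theorem exists_solution_concat {E : Type*} [NormedAddCommGroup E] [NormedSpace ℝ E] {v : E → E}
    {x y : ℝ → E} {a b : ℝ} (ha : 0 ≤ a) (hab : a ≤ b) (hxy : x a = y a)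
    (hx : ∀ t ∈ Icc 0 a, HasDerivWithinAt x (v (x t)) (Icc 0 a) t)
    (hy : ∀ t ∈ Icc a b, HasDerivWithinAt y (v (y t)) (Icc a b) t) :
    ∃ z : ℝ → E, z 0 = x 0 ∧ ∀ t ∈ Icc 0 b, HasDerivWithinAt z (v (z t)) (Icc 0 b) t := by
  classical
  let z : ℝ → E := fun t => if t ≤ a then x t else y t
  have hzx : ∀ t, t ≤ a → z t = x t := fun t ht => if_pos ht
  have hzy : ∀ t, a ≤ t → z t = y t := by
    intro t ht
    rcases ht.eq_or_lt with rfl | h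
    · rw [hzx _ le_rfl, hxy]
    · exact if_neg (not_le.2 h)
  refine ⟨z, hzx 0 ha, fun t ht => ?_⟩
  -- Off a closed piece the derivative within that piece is vacuous, so both statements hold for
  -- every `t` and can be joined by `union`.
  have h1 : HasDerivWithinAt z (v (z t)) (Icc 0 a) t := by
    by_cases h : t ≤ a
    · rw [hzx t h]
      exact (hx t ⟨ht.1, h⟩).congr (fun s hs => hzx s hs.2) (hzx t h)
    · exact HasFDerivWithinAt.of_notMem_closure
        (by rw [isClosed_Icc.closure_eq]; exact fun hh => h hh.2)
  have h2 : HasDerivWithinAt z (v (z t)) (Icc a b) t := by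
    by_cases h : a ≤ t
    · rw [hzy t h]
      exact (hy t ⟨h, ht.2⟩).congr (fun s hs => hzy s hs.1) (hzy t h)
    · exact HasFDerivWithinAt.of_notMem_closure
        (by rw [isClosed_Icc.closure_eq]; exact fun hh => h hh.1)
  simpa [Icc_union_Icc_eq_Icc ha hab] using h1.union h2

open Set in
/-- Solutions of an autonomous Lipschitz differential equation exist locally on an interval whose
length depends on the Lipschitz constant only. -/
theorem exists_solution_Icc {E : Type*} [NormedAddCommGroup E] [NormedSpace ℝ E] [CompleteSpace E]
    {v : E → E} {K : NNReal} (hv : LipschitzWith K v) (x₀ : E) (a : ℝ) :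
    ∃ x : ℝ → E, x a = x₀ ∧ ∀ t ∈ Icc a (a + 1 / (K + 1)),
      HasDerivWithinAt x (v (x t)) (Icc a (a + 1 / (K + 1))) t := by
  have hK : (0 : ℝ) < K + 1 := by positivity
  -- On the ball of radius `R = ‖v x₀‖ + 1` one has `‖v‖ ≤ K R + ‖v x₀‖ ≤ (K + 1) R`, so time `1 /
  -- (K + 1)` is just enough to stay inside.
  have h := IsPicardLindelof.of_time_independent (f := v) (tmin := a) (tmax := a + 1 / (K + 1))
    (t₀ := ⟨a, by simp; positivity⟩) (x₀ := x₀) (a := ‖v x₀‖₊ + 1) (r := 0)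
    (L := (K + 1) * (‖v x₀‖₊ + 1)) (K := K) ?_ (hv.lipschitzOnWith) ?_
  · exact h.exists_eq_forall_mem_Icc_hasDerivWithinAt₀
  · intro x hx
    have h1 := hv.norm_sub_le x x₀
    have h2 : ‖x - x₀‖ ≤ ‖v x₀‖ + 1 := by simpa [dist_eq_norm] using hx
    have h3 : ‖v x‖ ≤ ‖v x - v x₀‖ + ‖v x₀‖ := by simpa using norm_add_le (v x - v x₀) (v x₀)
    have h4 := mul_le_mul_of_nonneg_left h2 K.coe_nonneg
    push_cast
    linarith
  · have : max (a + 1 / ((K : ℝ) + 1) - a) (a - a) = 1 / (K + 1) := by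
      rw [max_eq_left] <;> simp; positivity
    simp only [this]
    push_cast
    field_simp
    simp

open Set in
/-- Global forward existence for autonomous Lipschitz differential equations. -/
theorem exists_solution_Ici {E : Type*} [NormedAddCommGroup E] [NormedSpace ℝ E] [CompleteSpace E]
    {v : E → E} {K : NNReal} (hv : LipschitzWith K v) (x₀ : E) :
    ∃ x : ℝ → E, x 0 = x₀ ∧ ∀ t, 0 ≤ t → HasDerivWithinAt x (v (x t)) (Ici 0) t := by
  have hK : (0 : ℝ) < 1 / (K + 1) := by positivity
  have hex : ∀ n : ℕ, ∃ x : ℝ → E, x 0 = x₀ ∧ ∀ t ∈ Icc 0 (n * (1 / (K + 1) : ℝ)),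
      HasDerivWithinAt x (v (x t)) (Icc 0 (n * (1 / (K + 1) : ℝ))) t := by
    intro n
    induction n with
    | zero =>
      refine ⟨fun _ => x₀, rfl, fun t ht => ?_⟩
      simp only [CharP.cast_eq_zero, zero_mul, Icc_self]
      exact HasFDerivWithinAt.of_subsingleton (by simp)
    | succ n ih =>
      obtain ⟨x, hx0, hx⟩ := ih
      obtain ⟨y, hy0, hy⟩ := exists_solution_Icc hv (x (n * (1 / (K + 1) : ℝ)))
        (n * (1 / (K + 1) : ℝ))
      obtain ⟨z, hz0, hz⟩ := exists_solution_concat (by positivity) (by linarith) hy0.symm hx hy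
      refine ⟨z, hz0.trans hx0, ?_⟩
      have : ((n + 1 : ℕ) : ℝ) * (1 / (K + 1) : ℝ) = n * (1 / (K + 1) : ℝ) + 1 / (K + 1) := by
        push_cast; ring
      rw [this]
      exact hz
  have hex' : ∀ T : ℝ, ∃ x : ℝ → E, x 0 = x₀ ∧ ∀ t ∈ Icc 0 T,
      HasDerivWithinAt x (v (x t)) (Icc 0 T) t := by
    intro T
    obtain ⟨n, hn⟩ := exists_nat_ge (T / (1 / (K + 1) : ℝ))
    rw [div_le_iff₀ hK] at hn
    obtain ⟨x, hx0, hx⟩ := hex n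
    exact ⟨x, hx0, fun t ht => (hx t ⟨ht.1, ht.2.trans hn⟩).mono (Icc_subset_Icc_right hn)⟩
  choose X hX0 hX using hex'
  have huniq : ∀ S T, S ≤ T → EqOn (X S) (X T) (Icc 0 S) := by
    intro S T hST
    have key : ∀ R, S ≤ R → ContinuousOn (X R) (Icc 0 S) ∧
        ∀ t ∈ Ico 0 S, HasDerivWithinAt (X R) (v (X R t)) (Ici t) t := by
      intro R hR
      refine ⟨fun t ht => ((hX R t ⟨ht.1, ht.2.trans hR⟩).continuousWithinAt).mono
        (Icc_subset_Icc_right hR), fun t ht => ?_⟩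
      refine (hX R t ⟨ht.1, ht.2.le.trans hR⟩).mono_of_mem_nhdsWithin ?_
      exact Filter.mem_of_superset (Icc_mem_nhdsGE (ht.2.trans_le hR))
        (Icc_subset_Icc_left ht.1)
    exact ODE_solution_unique_of_mem_Icc_right (v := fun _ => v) (s := fun _ => univ) (K := K)
      (fun t _ => hv.lipschitzOnWith) (key S le_rfl).1 (key S le_rfl).2 (fun _ _ => mem_univ _)
      (key T hST).1 (key T hST).2 (fun _ _ => mem_univ _) (by rw [hX0, hX0])
  -- The `+ 1` leaves room to the right of `t`, so that near `t` the glued function agrees with the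
  -- single solution `X (t + 1)`.
  refine ⟨fun t => X (t + 1) t, by simp [hX0], fun t ht => ?_⟩
  have h1 := hX (t + 1) t ⟨ht, by linarith⟩
  have h2 : HasDerivWithinAt (X (t + 1)) (v (X (t + 1) t)) (Ici 0) t :=
    h1.mono_of_mem_nhdsWithin (by
      rw [← Ici_inter_Iic]
      exact Filter.inter_mem self_mem_nhdsWithin
        (mem_nhdsWithin_of_mem_nhds (Iic_mem_nhds (by linarith))))
  refine h2.congr_of_eventuallyEq ?_ rfl
  have hn : ∀ᶠ s in nhdsWithin t (Ici 0), s < t + 1 :=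
    mem_nhdsWithin_of_mem_nhds (Iio_mem_nhds (by linarith))
  filter_upwards [hn, self_mem_nhdsWithin] with s hs hs0
  rcases le_total s t with h | h
  · exact huniq (s + 1) (t + 1) (by linarith) ⟨hs0, by linarith⟩
  · exact (huniq (t + 1) (s + 1) (by linarith) ⟨hs0, hs.le⟩).symm

/-! ### Monotonicity, decay and Barbalat-type lemmas on the half-line -/

open Set in
/-- A differentiable function on `[0, ∞)` with nonpositive derivative is nonincreasing. -/
theorem antitoneOn_Ici_of_hasDerivWithinAt {V V' : ℝ → ℝ}
    (hV : ∀ t, 0 ≤ t → HasDerivWithinAt V (V' t) (Ici 0) t) (hV' : ∀ t, 0 ≤ t → V' t ≤ 0) :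
    AntitoneOn V (Ici 0) := by
  refine antitoneOn_of_deriv_nonpos (convex_Ici 0) (fun t ht => (hV t ht).continuousWithinAt) ?_ ?_
  · intro t ht
    exact (hV t (interior_subset ht)).differentiableWithinAt.mono interior_subset
  · intro t ht
    rw [interior_Ici] at ht
    rw [((hV t ht.le).hasDerivAt (Ici_mem_nhds ht)).deriv]
    exact hV' t ht.le

open Set in
/-- Exponential decay from the differential inequality `V' ≤ -ρ V`. -/
theorem le_mul_exp_of_hasDerivWithinAt {V V' : ℝ → ℝ} {ρ : ℝ}
    (hV : ∀ t, 0 ≤ t → HasDerivWithinAt V (V' t) (Ici 0) t) (hV' : ∀ t, 0 ≤ t → V' t ≤ -ρ * V t)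
    {t : ℝ} (ht : 0 ≤ t) : V t ≤ V 0 * Real.exp (-ρ * t) := by
  have hE : ∀ t : ℝ, HasDerivAt (fun s : ℝ => Real.exp (ρ * s)) (Real.exp (ρ * t) * ρ) t := by
    intro t
    simpa using ((hasDerivAt_id t).const_mul ρ).exp
  have h := antitoneOn_Ici_of_hasDerivWithinAt (V := fun s => V s * Real.exp (ρ * s))
    (fun t ht => (hV t ht).mul (hE t).hasDerivWithinAt) (fun t ht => by
      have h1 := mul_le_mul_of_nonneg_right (hV' t ht) (Real.exp_pos (ρ * t)).le
      linarith) (Set.mem_Ici.2 le_rfl) ht ht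
  simp only [mul_zero, Real.exp_zero, mul_one] at h
  have h2 : Real.exp (-ρ * t) = (Real.exp (ρ * t))⁻¹ := by rw [← Real.exp_neg]; ring_nf
  rw [h2, ← div_eq_mul_inv, le_div_iff₀ (Real.exp_pos _)]
  exact h

open Set Filter Topology in
/-- Barbalat's lemma: if `V` converges and its derivative is uniformly continuous, then the
derivative vanishes at infinity. -/
theorem tendsto_zero_of_uniformContinuousOn {V φ : ℝ → ℝ} {l : ℝ}
    (hV : ∀ t, 0 ≤ t → HasDerivWithinAt V (-φ t) (Ici 0) t) (hl : Tendsto V atTop (𝓝 l))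
    (hφ : UniformContinuousOn φ (Ici 0)) : Tendsto φ atTop (𝓝 0) := by
  rw [Metric.tendsto_atTop]
  intro ε hε
  obtain ⟨δ, hδ, h⟩ := Metric.uniformContinuousOn_iff.1 hφ (ε / 2) (by positivity)
  have hd : Tendsto (fun t => (V (t + δ / 2) - V t) / (δ / 2)) atTop (𝓝 0) := by
    have := ((hl.comp (tendsto_atTop_add_const_right atTop (δ / 2) tendsto_id)).sub hl).div_const
      (δ / 2)
    simpa using this
  obtain ⟨T, hT⟩ := Metric.tendsto_atTop.1 hd (ε / 2) (by positivity)
  refine ⟨max T 0, fun t ht => ?_⟩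
  have ht0 : 0 ≤ t := (le_max_right _ _).trans ht
  -- Subtracting the linear motion of slope `-φ t` leaves a derivative of size at most `ε / 2` on
  -- this window, so `-φ t` is within `ε / 2` of a difference quotient of `V`, which tends to zero.
  have h1 := Convex.norm_image_sub_le_of_norm_hasDerivWithin_le (𝕜 := ℝ)
    (f := fun s => V s + (s - t) * φ t) (f' := fun s => -φ s + φ t) (s := Icc t (t + δ / 2))
    (x := t) (y := t + δ / 2) (C := ε / 2) ?_ ?_ (convex_Icc _ _) ⟨le_rfl, by linarith⟩
    ⟨by linarith, le_rfl⟩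
  · have h2 := hT t ((le_max_left _ _).trans ht)
    rw [Real.dist_eq, sub_zero, abs_div, abs_of_pos (half_pos hδ), div_lt_iff₀ (half_pos hδ)] at h2
    simp only [Real.norm_eq_abs, add_sub_cancel_left, sub_self, zero_mul, add_zero,
      abs_of_pos (half_pos hδ)] at h1
    rw [Real.dist_eq, sub_zero]
    have h3 : |δ / 2 * φ t| < ε * (δ / 2) := by
      calc |δ / 2 * φ t| = |(V (t + δ / 2) + δ / 2 * φ t - V t) - (V (t + δ / 2) - V t)| := by
            congr 1; ring
        _ ≤ |V (t + δ / 2) + δ / 2 * φ t - V t| + |V (t + δ / 2) - V t| := abs_sub _ _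
        _ < ε * (δ / 2) := by linarith
    rw [abs_mul, abs_of_pos (half_pos hδ), mul_comm] at h3
    exact lt_of_mul_lt_mul_right h3 (half_pos hδ).le
  · intro s hs
    refine ((hV s (ht0.trans hs.1)).mono fun r hr => ht0.trans hr.1).add ?_
    simpa using (((hasDerivAt_id s).sub_const t).mul_const (φ t)).hasDerivWithinAt
  · intro s hs
    have := h s (ht0.trans hs.1) t ht0 (by
      rw [Real.dist_eq, abs_of_nonneg (by linarith [hs.1])]; linarith [hs.2])
    rw [dist_comm, Real.dist_eq] at this
    rw [Real.norm_eq_abs, neg_add_eq_sub]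
    exact this.le

open Set Filter Topology in
/-- If `u` is bounded and `u' = -(z + ψ)` with `ψ → 0` and `z' → 0`, then `z → 0`. -/
theorem tendsto_zero_of_bounded_primitive {E : Type*} [NormedAddCommGroup E] [NormedSpace ℝ E]
    {u z ψ ζ : ℝ → E} {B : ℝ} (hB : ∀ t, 0 ≤ t → ‖u t‖ ≤ B)
    (hu : ∀ t, 0 ≤ t → HasDerivWithinAt u (-(z t + ψ t)) (Ici 0) t)
    (hz : ∀ t, 0 ≤ t → HasDerivWithinAt z (ζ t) (Ici 0) t)
    (hψ : Tendsto ψ atTop (𝓝 0)) (hζ : Tendsto ζ atTop (𝓝 0)) : Tendsto z atTop (𝓝 0) := by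
  have hB0 : 0 ≤ B := (norm_nonneg _).trans (hB 0 le_rfl)
  rw [Metric.tendsto_atTop]
  intro ε hε
  -- Over a window of length `T`, `u` moves by `-T • z t` up to `(η T + η) T = ε T / 4`, but by at
  -- most `2 B` in total. As `4 B < ε T`, this excludes `‖z t‖ ≥ ε`.
  obtain ⟨T, hT⟩ : ∃ T : ℝ, T = (4 * B + 1) / ε := ⟨_, rfl⟩
  have hTpos : 0 < T := by rw [hT]; positivity
  obtain ⟨η, hη⟩ : ∃ η : ℝ, η = ε / (4 * (1 + T)) := ⟨_, rfl⟩
  have hηpos : 0 < η := by rw [hη]; positivity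
  obtain ⟨T₁, hT₁⟩ := Metric.tendsto_atTop.1 hψ η hηpos
  obtain ⟨T₂, hT₂⟩ := Metric.tendsto_atTop.1 hζ η hηpos
  refine ⟨max 0 (max T₁ T₂), fun t ht => ?_⟩
  have ht0 : 0 ≤ t := (le_max_left _ _).trans ht
  have ht1 : T₁ ≤ t := (le_max_left _ _).trans ((le_max_right _ _).trans ht)
  have ht2 : T₂ ≤ t := (le_max_right _ _).trans ((le_max_right _ _).trans ht)
  have hsub : Icc t (t + T) ⊆ Ici 0 := fun r hr => ht0.trans hr.1
  have hz' : ∀ s ∈ Icc t (t + T), ‖z s - z t‖ ≤ η * T := by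
    intro s hs
    have h1 := Convex.norm_image_sub_le_of_norm_hasDerivWithin_le (𝕜 := ℝ) (C := η)
      (fun s hs => (hz s (hsub hs)).mono hsub)
      (fun s hs => (by simpa using (hT₂ s (ht2.trans hs.1)).le)) (convex_Icc t (t + T))
      (left_mem_Icc.2 (by linarith)) hs
    refine h1.trans ?_
    rw [Real.norm_eq_abs, abs_of_nonneg (by linarith [hs.1])]
    gcongr
    linarith [hs.2]
  have h1 := Convex.norm_image_sub_le_of_norm_hasDerivWithin_le (𝕜 := ℝ)
    (f := fun s => u s + (s - t) • z t) (f' := fun s => -(z s + ψ s) + z t) (s := Icc t (t + T))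
    (x := t) (y := t + T) (C := η * T + η) ?_ ?_ (convex_Icc _ _) ⟨le_rfl, by linarith⟩
    ⟨by linarith, le_rfl⟩
  · simp only [add_sub_cancel_left, sub_self, zero_smul, add_zero, Real.norm_eq_abs,
      abs_of_pos hTpos] at h1
    have h2 : T * ‖z t‖ ≤ 2 * B + (η * T + η) * T := by
      calc T * ‖z t‖ = ‖T • z t‖ := by rw [norm_smul, Real.norm_eq_abs, abs_of_pos hTpos]
        _ = ‖(u (t + T) + T • z t - u t) + (u t - u (t + T))‖ := by congr 1; abel
        _ ≤ ‖u (t + T) + T • z t - u t‖ + ‖u t - u (t + T)‖ := norm_add_le _ _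
        _ ≤ 2 * B + (η * T + η) * T := by
          have := norm_sub_le (u t) (u (t + T))
          linarith [hB t ht0, hB (t + T) (by linarith)]
    have h3 : (η * T + η) = ε / 4 := by rw [hη]; field_simp; ring
    have h4 : 4 * B < ε * T := by rw [hT]; field_simp; linarith
    rw [dist_zero_right]
    rw [h3] at h2
    by_contra hcon
    have : T * ε ≤ T * ‖z t‖ := by gcongr; linarith
    nlinarith
  · intro s hs
    refine ((hu s (hsub hs)).mono hsub).add ?_
    simpa using (((hasDerivAt_id s).sub_const t).smul_const (z t)).hasDerivWithinAt
  · intro s hs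
    have h5 := hz' s hs
    have h6 : ‖ψ s‖ < η := by simpa using hT₁ s (ht1.trans hs.1)
    calc ‖-(z s + ψ s) + z t‖ = ‖(z s - z t) + ψ s‖ := by rw [← norm_neg]; congr 1; abel
      _ ≤ ‖z s - z t‖ + ‖ψ s‖ := norm_add_le _ _
      _ ≤ η * T + η := by linarith

/-! ### Symmetric and positive semidefinite operators -/

section PositiveSemidefinite

variable {E : Type*} [NormedAddCommGroup E] [InnerProductSpace ℝ E]

/-- For a positive semidefinite symmetric operator `M`, `‖M x‖²` is controlled by the quadratic
form. -/
theorem norm_sq_le_of_psd {M : E →L[ℝ] E} (hM : ∀ x y, inner ℝ (M x) y = inner ℝ x (M y))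
    (hM0 : ∀ x, 0 ≤ inner ℝ x (M x)) (x : E) :
    ‖M x‖ ^ 2 ≤ (‖M‖ + 1) * inner ℝ x (M x) := by
  have hs : (0 : ℝ) < ‖M‖ + 1 := by positivity
  -- Testing positivity at `s x - M x` with `s = ‖M‖ + 1` gives the bound after expansion; the `+ 1`
  -- keeps `s` positive when `M = 0`.
  have h := hM0 ((‖M‖ + 1) • x - M x)
  have h1 : inner ℝ (M x) (M (M x)) ≤ ‖M‖ * ‖M x‖ ^ 2 := by
    calc inner ℝ (M x) (M (M x)) ≤ ‖M x‖ * ‖M (M x)‖ := real_inner_le_norm _ _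
      _ ≤ ‖M x‖ * (‖M‖ * ‖M x‖) := by gcongr; exact M.le_opNorm _
      _ = ‖M‖ * ‖M x‖ ^ 2 := by ring
  simp only [map_sub, map_smul, inner_sub_left, inner_sub_right, inner_smul_left,
    inner_smul_right, RCLike.conj_to_real, ← hM x (M x), real_inner_self_eq_norm_sq] at h
  have h2 : 0 ≤ (‖M‖ + 1) * ((‖M‖ + 1) * inner ℝ x (M x) - ‖M x‖ ^ 2) := by
    nlinarith [sq_nonneg ‖M x‖]
  have := nonneg_of_mul_nonneg_right h2 hs
  linarith

/-- Every value of a linear operator on a finite-dimensional space has a preimage of comparable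
norm. -/
theorem exists_preimage_norm_le_of_finiteDimensional [FiniteDimensional ℝ E] (M : E →L[ℝ] E) :
    ∃ C : ℝ, 0 < C ∧ ∀ x, ∃ y, M y = M x ∧ ‖y‖ ≤ C * ‖M x‖ := by
  have := FiniteDimensional.complete ℝ E
  have : CompleteSpace M.range := FiniteDimensional.complete ℝ _
  obtain ⟨C, hC, h⟩ := ContinuousLinearMap.exists_preimage_norm_le (M.rangeRestrict)
    (LinearMap.surjective_rangeRestrict (M : E →ₗ[ℝ] E))
  refine ⟨C, hC, fun x => ?_⟩
  obtain ⟨y, hy, hyn⟩ := h (M.rangeRestrict x)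
  exact ⟨y, congrArg Subtype.val hy, hyn⟩

/-- The quadratic form of a symmetric operator on a finite-dimensional space is controlled by
`‖M x‖²`. -/
theorem exists_inner_le_norm_sq [FiniteDimensional ℝ E] {M : E →L[ℝ] E}
    (hM : ∀ x y, inner ℝ (M x) y = inner ℝ x (M y)) :
    ∃ C : ℝ, 0 < C ∧ ∀ x, inner ℝ x (M x) ≤ C * ‖M x‖ ^ 2 := by
  obtain ⟨C, hC, h⟩ := exists_preimage_norm_le_of_finiteDimensional M
  refine ⟨C, hC, fun x => ?_⟩
  obtain ⟨y, hy, hyn⟩ := h x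
  -- By symmetry the form does not see the kernel, so `x` may be replaced by its short
  -- representative `y`.
  calc inner ℝ x (M x) = inner ℝ y (M x) := by rw [← hy, ← hM, ← hy, hM]
    _ ≤ ‖y‖ * ‖M x‖ := real_inner_le_norm _ _
    _ ≤ C * ‖M x‖ * ‖M x‖ := by gcongr
    _ = C * ‖M x‖ ^ 2 := by ring

/-- The range of a symmetric operator on a finite-dimensional space is the orthogonal complement
of its kernel. -/
theorem exists_preimage_of_orthogonal_ker [FiniteDimensional ℝ E] {M : E →L[ℝ] E}
    (hM : ∀ x y, inner ℝ (M x) y = inner ℝ x (M y)) {b : E}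
    (hb : ∀ v, M v = 0 → inner ℝ v b = 0) : ∃ w, M w = b := by
  have hsym : (M : E →ₗ[ℝ] E).IsSymmetric := hM
  have h1 : b ∈ (LinearMap.ker (M : E →ₗ[ℝ] E))ᗮ := (Submodule.mem_orthogonal _ _).2
    fun v hv => hb v hv
  rw [← hsym.orthogonal_range, Submodule.orthogonal_orthogonal] at h1
  exact h1

end PositiveSemidefinite

/-! ### Damped oscillators with cocoercive friction -/

/-- `(u, w)` solves `w' = u`, `u' = -(g u + M u + M w)` on `[0, ∞)`. -/
structure IsDampedTrajectory {E : Type*} [NormedAddCommGroup E] [InnerProductSpace ℝ E]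
    (M : E →L[ℝ] E) (g : E → E) (u w : ℝ → E) : Prop where
  deriv_velocity : ∀ t, 0 ≤ t →
    HasDerivWithinAt u (-(g (u t) + M (u t) + M (w t))) (Set.Ici 0) t
  deriv_position : ∀ t, 0 ≤ t → HasDerivWithinAt w (u t) (Set.Ici 0) t

/-- The map `g` is cocoercive with constant `c`. -/
def Cocoercive {E : Type*} [NormedAddCommGroup E] [InnerProductSpace ℝ E] (c : ℝ) (g : E → E) :
    Prop :=
  ∀ x y, c * ‖g x - g y‖ ^ 2 ≤ inner ℝ (g x - g y) (x - y)

section Damped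

variable {E : Type*} [NormedAddCommGroup E] [InnerProductSpace ℝ E]

theorem Cocoercive.norm_sub_le {c : ℝ} (hc : 0 < c) {g : E → E} (hg : Cocoercive c g) (x y : E) :
    ‖g x - g y‖ ≤ c⁻¹ * ‖x - y‖ := by
  rw [inv_mul_eq_div, le_div_iff₀' hc]
  rcases eq_or_ne (g x - g y) 0 with h | h
  · simp [h]
  · have h1 := (hg x y).trans (real_inner_le_norm _ _)
    have h2 : 0 < ‖g x - g y‖ := norm_pos_iff.2 h
    refine le_of_mul_le_mul_right ?_ h2
    linarith

theorem Cocoercive.continuous {c : ℝ} (hc : 0 < c) {g : E → E} (hg : Cocoercive c g) :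
    Continuous g :=
  (LipschitzWith.of_dist_le_mul (K := (c⁻¹).toNNReal) fun x y => by
    rw [dist_eq_norm, dist_eq_norm, Real.coe_toNNReal _ (inv_pos.2 hc).le]
    exact hg.norm_sub_le hc x y).continuous

/-- The energy of a damped trajectory relative to the equilibrium velocity `a`. -/
noncomputable def energy (M : E →L[ℝ] E) (u w : ℝ → E) (a : E) (t : ℝ) : ℝ :=
  (1 / 2) * ‖u t - a‖ ^ 2 + (1 / 2) * inner ℝ (w t) (M (w t))

variable {M : E →L[ℝ] E} {g : E → E} {u w : ℝ → E} {c : ℝ}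

/-- The elastic power `⟪u, M w⟫` cancels by symmetry of `M`. The shift by `a` costs nothing because
`a`, lying in `ker M`, is orthogonal to the range of `M`. -/
theorem IsDampedTrajectory.hasDerivWithinAt_energy (h : IsDampedTrajectory M g u w)
    (hM : ∀ x y, inner ℝ (M x) y = inner ℝ x (M y)) {a : E} (ha : M a = 0) {t : ℝ} (ht : 0 ≤ t) :
    HasDerivWithinAt (energy M u w a)
      (-(inner ℝ (u t - a) (g (u t)) + inner ℝ (u t) (M (u t)))) (Set.Ici 0) t := by
  have h1 := ((h.deriv_velocity t ht).sub_const a).norm_sq.const_mul (1 / 2)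
  have h2 := ((h.deriv_position t ht).inner ℝ
    (M.hasFDerivAt.comp_hasDerivWithinAt t (h.deriv_position t ht))).const_mul (1 / 2)
  refine (h1.add h2).congr_deriv ?_
  have e1 : inner ℝ a (M (u t)) = 0 := by rw [← hM, ha, inner_zero_left]
  have e2 : inner ℝ a (M (w t)) = 0 := by rw [← hM, ha, inner_zero_left]
  have e3 : inner ℝ (w t) (M (u t)) = inner ℝ (u t) (M (w t)) := by
    rw [← hM, real_inner_comm]
  simp only [Function.comp, inner_sub_left, inner_neg_right, inner_add_right, e1, e2, e3]
  ring

/-- Cocoercivity between `u t` and `a` gives the sign. Leaving the equilibrium `a` free allows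
recentring at the limit once it is known. -/
theorem IsDampedTrajectory.antitoneOn_energy (h : IsDampedTrajectory M g u w)
    (hM : ∀ x y, inner ℝ (M x) y = inner ℝ x (M y)) (hM0 : ∀ x, 0 ≤ inner ℝ x (M x))
    (hc : 0 < c) (hg : Cocoercive c g) {a : E} (ha : M a = 0) (hga : g a = 0) :
    AntitoneOn (energy M u w a) (Set.Ici 0) := by
  refine antitoneOn_Ici_of_hasDerivWithinAt (fun t ht => h.hasDerivWithinAt_energy hM ha ht) ?_
  intro t _
  have h1 := hg (u t) a
  rw [hga, sub_zero, real_inner_comm] at h1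
  have h2 := hM0 (u t)
  have h3 : 0 ≤ c * ‖g (u t)‖ ^ 2 := by positivity
  linarith

theorem norm_sub_sq_le_energy (hM0 : ∀ x, 0 ≤ inner ℝ x (M x)) (a : E) (t : ℝ) :
    ‖u t - a‖ ^ 2 ≤ 2 * energy M u w a t := by
  have := hM0 (w t)
  unfold energy
  linarith

/-- The position `w` may drift along `ker M`; only the force `M w` is bounded by the energy. -/
theorem norm_sq_le_energy (hM : ∀ x y, inner ℝ (M x) y = inner ℝ x (M y))
    (hM0 : ∀ x, 0 ≤ inner ℝ x (M x)) (a : E) (t : ℝ) :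
    ‖M (w t)‖ ^ 2 ≤ (‖M‖ + 1) * (2 * energy M u w a t) := by
  refine (norm_sq_le_of_psd hM hM0 (w t)).trans ?_
  have : 0 ≤ ‖u t - a‖ ^ 2 := by positivity
  gcongr
  unfold energy
  linarith

theorem energy_nonneg (hM0 : ∀ x, 0 ≤ inner ℝ x (M x)) (a : E) (t : ℝ) :
    0 ≤ energy M u w a t := by
  have := hM0 (w t)
  unfold energy
  positivity

open Set Filter Topology in
theorem tendsto_of_antitoneOn_of_nonneg {V : ℝ → ℝ} (hV : AntitoneOn V (Ici 0))
    (hV0 : ∀ t, 0 ≤ V t) : ∃ l, Tendsto V atTop (𝓝 l) := by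
  have h1 : Antitone fun t => V (max t 0) := fun s t hst =>
    hV (mem_Ici.2 (le_max_right _ _)) (mem_Ici.2 (le_max_right _ _)) (max_le_max_right _ hst)
  refine ⟨_, (tendsto_atTop_ciInf h1 ⟨0, ?_⟩).congr' ?_⟩
  · rintro _ ⟨t, rfl⟩
    exact hV0 _
  · filter_upwards [eventually_ge_atTop 0] with t ht
    rw [max_eq_left ht]

open Set Filter Topology in
/-- Along a damped trajectory, the dissipation `⟪u, g u⟫ + ⟪u, M u⟫` vanishes at infinity. -/
theorem IsDampedTrajectory.tendsto_dissipation [FiniteDimensional ℝ E]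
    (h : IsDampedTrajectory M g u w)
    (hM : ∀ x y, inner ℝ (M x) y = inner ℝ x (M y)) (hM0 : ∀ x, 0 ≤ inner ℝ x (M x))
    (hc : 0 < c) (hg : Cocoercive c g) (hg0 : g 0 = 0) :
    Tendsto (fun t => inner ℝ (u t) (g (u t)) + inner ℝ (u t) (M (u t))) atTop (𝓝 0) := by
  have hanti := h.antitoneOn_energy hM hM0 hc hg (map_zero M) hg0
  have hE : ∀ t, 0 ≤ t → energy M u w 0 t ≤ energy M u w 0 0 := fun t ht =>
    hanti (mem_Ici.2 le_rfl) ht ht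
  have hE0 := energy_nonneg (u := u) (w := w) hM0 0 0
  obtain ⟨B, hBdef⟩ : ∃ B, B = √(2 * energy M u w 0 0) := ⟨_, rfl⟩
  obtain ⟨D, hDdef⟩ : ∃ D, D = √((‖M‖ + 1) * (2 * energy M u w 0 0)) := ⟨_, rfl⟩
  have hB : ∀ t, 0 ≤ t → ‖u t‖ ≤ B := by
    intro t ht
    rw [hBdef]
    refine Real.le_sqrt_of_sq_le ?_
    have := norm_sub_sq_le_energy (u := u) (w := w) hM0 0 t
    rw [sub_zero] at this
    linarith [hE t ht]
  have hD : ∀ t, 0 ≤ t → ‖M (w t)‖ ≤ D := by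
    intro t ht
    rw [hDdef]
    refine Real.le_sqrt_of_sq_le ((norm_sq_le_energy (u := u) hM hM0 0 t).trans ?_)
    gcongr
    exact hE t ht
  have hB0 : 0 ≤ B := by rw [hBdef]; positivity
  -- The bounded derivative makes `u` Lipschitz; composed with a continuous function on a compact
  -- ball, this gives the uniform continuity Barbalat's lemma needs.
  have hlip : ∀ s ∈ Ici (0 : ℝ), ∀ t ∈ Ici (0 : ℝ),
      ‖u t - u s‖ ≤ (c⁻¹ * B + ‖M‖ * B + D) * ‖t - s‖ := by
    intro s hs t ht
    refine Convex.norm_image_sub_le_of_norm_hasDerivWithin_le (𝕜 := ℝ)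
      (fun t ht => h.deriv_velocity t ht) (fun t ht => ?_) (convex_Ici 0) hs ht
    rw [norm_neg]
    have h1 := hg.norm_sub_le hc (u t) 0
    rw [hg0, sub_zero, sub_zero] at h1
    have h2 : c⁻¹ * ‖u t‖ ≤ c⁻¹ * B := mul_le_mul_of_nonneg_left (hB t ht) (inv_pos.2 hc).le
    have h3 : ‖M‖ * ‖u t‖ ≤ ‖M‖ * B := mul_le_mul_of_nonneg_left (hB t ht) (norm_nonneg _)
    have := norm_add₃_le (a := g (u t)) (b := M (u t)) (c := M (w t))
    linarith [hD t ht, M.le_opNorm (u t)]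
  have hD0 : 0 ≤ D := by rw [hDdef]; positivity
  have hcinv : 0 < c⁻¹ := inv_pos.2 hc
  have hLu : LipschitzOnWith (c⁻¹ * B + ‖M‖ * B + D).toNNReal u (Ici 0) :=
    LipschitzOnWith.of_dist_le_mul fun s hs t ht => by
      rw [dist_eq_norm, dist_eq_norm, Real.coe_toNNReal _ (by positivity)]
      exact hlip t ht s hs
  have hgc := hg.continuous hc
  have hΦ : UniformContinuousOn (fun x => inner ℝ x (g x) + inner ℝ x (M x))
      (Metric.closedBall (0 : E) B) :=
    (isCompact_closedBall 0 B).uniformContinuousOn_of_continuous (by fun_prop)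
  obtain ⟨l, hl⟩ := tendsto_of_antitoneOn_of_nonneg hanti (fun t => energy_nonneg hM0 0 t)
  refine tendsto_zero_of_uniformContinuousOn (fun t ht => ?_) hl
    (hΦ.comp hLu.uniformContinuousOn fun t ht => by simpa using hB t ht)
  simpa using h.hasDerivWithinAt_energy hM (map_zero M) ht

open Set Filter Topology in
/-- A damped trajectory has a limiting velocity, which is an equilibrium. -/
theorem IsDampedTrajectory.exists_tendsto [FiniteDimensional ℝ E]
    (h : IsDampedTrajectory M g u w)
    (hM : ∀ x y, inner ℝ (M x) y = inner ℝ x (M y)) (hM0 : ∀ x, 0 ≤ inner ℝ x (M x))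
    (hc : 0 < c) (hg : Cocoercive c g) (hg0 : g 0 = 0) :
    ∃ a, M a = 0 ∧ g a = 0 ∧ Tendsto u atTop (𝓝 a) := by
  have hanti := h.antitoneOn_energy hM hM0 hc hg (map_zero M) hg0
  have hφ := h.tendsto_dissipation hM hM0 hc hg hg0
  have hcoc : ∀ x, c * ‖g x‖ ^ 2 ≤ inner ℝ x (g x) := by
    intro x
    have := hg x 0
    rwa [hg0, sub_zero, sub_zero, real_inner_comm] at this
  have hB : ∀ t, 0 ≤ t → ‖u t‖ ≤ √(2 * energy M u w 0 0) := by
    intro t ht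
    refine Real.le_sqrt_of_sq_le ?_
    have := norm_sub_sq_le_energy (u := u) (w := w) hM0 0 t
    rw [sub_zero] at this
    linarith [hanti (mem_Ici.2 le_rfl) ht ht]
  have htend : ∀ (F : E → E) (k : ℝ), 0 < k →
      (∀ x, k * ‖F x‖ ^ 2 ≤ inner ℝ x (g x) + inner ℝ x (M x)) →
      Tendsto (fun t => F (u t)) atTop (𝓝 0) := by
    intro F k hk hF
    have h1 : Tendsto (fun t => √(k⁻¹ * (inner ℝ (u t) (g (u t)) + inner ℝ (u t) (M (u t)))))
        atTop (𝓝 0) := by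
      have := (hφ.const_mul k⁻¹).sqrt
      simpa using this
    refine squeeze_zero_norm (fun t => ?_) h1
    refine Real.le_sqrt_of_sq_le ?_
    rw [inv_mul_eq_div, le_div_iff₀' hk]
    exact hF (u t)
  have hgu : Tendsto (fun t => g (u t)) atTop (𝓝 0) :=
    htend g c hc fun x => by linarith [hcoc x, hM0 x]
  have hMu : Tendsto (fun t => M (u t)) atTop (𝓝 0) := by
    refine htend M (‖M‖ + 1)⁻¹ (by positivity) fun x => ?_
    rw [inv_mul_le_iff₀ (by positivity)]
    have h1 : 0 ≤ inner ℝ x (g x) := (by positivity : 0 ≤ c * ‖g x‖ ^ 2).trans (hcoc x)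
    have h2 : 0 ≤ (‖M‖ + 1) * inner ℝ x (g x) := by positivity
    linarith [norm_sq_le_of_psd hM hM0 x]
  -- Here `u' = -(M w + o(1))` with `u` bounded, while `(M w)' = M u → 0`.
  have hMw : Tendsto (fun t => M (w t)) atTop (𝓝 0) := by
    refine tendsto_zero_of_bounded_primitive (ψ := fun t => g (u t) + M (u t)) hB
      (fun t ht => (h.deriv_velocity t ht).congr_deriv (by rw [add_comm (M (w t))]))
      (fun t ht => M.hasFDerivAt.comp_hasDerivWithinAt t (h.deriv_position t ht)) ?_ hMu
    simpa using hgu.add hMu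
  obtain ⟨a, -, σ, hσ, hσa⟩ := (isCompact_closedBall (0 : E) √(2 * energy M u w 0 0)).tendsto_subseq
    (x := fun n : ℕ => u n) (fun n => by simpa using hB n n.cast_nonneg)
  have hσt : Tendsto (fun n => ((σ n : ℕ) : ℝ)) atTop atTop :=
    tendsto_natCast_atTop_atTop.comp hσ.tendsto_atTop
  have hMa : M a = 0 := tendsto_nhds_unique
    ((M.continuous.tendsto a).comp hσa) (hMu.comp hσt)
  have hga : g a = 0 := tendsto_nhds_unique
    (((hg.continuous hc).tendsto a).comp hσa) (hgu.comp hσt)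
  refine ⟨a, hMa, hga, ?_⟩
  -- The energy centred at `a` converges, so its limit can be read off along the subsequence; `⟪w, M
  -- w⟫ ≤ C ‖M w‖²` removes the potential part without any bound on `w`.
  have hanti' := h.antitoneOn_energy hM hM0 hc hg hMa hga
  obtain ⟨l, hl⟩ := tendsto_of_antitoneOn_of_nonneg hanti' (fun t => energy_nonneg hM0 a t)
  obtain ⟨C, hC, hCM⟩ := exists_inner_le_norm_sq hM
  have hseq : Tendsto (fun n => energy M u w a (σ n : ℕ)) atTop (𝓝 0) := by
    have h1 : Tendsto (fun n => (1 / 2) * ‖u (σ n : ℕ) - a‖ ^ 2 +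
        (1 / 2) * (C * ‖M (w (σ n : ℕ))‖ ^ 2)) atTop (𝓝 0) := by
      have e1 := (hσa.sub_const a).norm.pow 2
      have e2 := (hMw.comp hσt).norm.pow 2
      have := (e1.const_mul (1 / 2)).add ((e2.const_mul C).const_mul (1 / 2))
      simpa [Function.comp_def] using this
    refine squeeze_zero (fun n => energy_nonneg hM0 a _) (fun n => ?_) h1
    have := hCM (w (σ n : ℕ))
    unfold energy
    linarith
  have hl0 : l = 0 := tendsto_nhds_unique (hl.comp hσt) hseq
  rw [hl0] at hl
  rw [tendsto_iff_norm_sub_tendsto_zero]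
  have h2 : Tendsto (fun t => √(2 * energy M u w a t)) atTop (𝓝 0) := by
    simpa using (hl.const_mul 2).sqrt
  exact squeeze_zero (fun t => norm_nonneg _)
    (fun t => Real.le_sqrt_of_sq_le (norm_sub_sq_le_energy hM0 a t)) h2

/-- If the dissipation dominates `‖u‖²`, damped trajectories decay exponentially, with constants
independent of the trajectory. -/
theorem exists_exponential_decay [FiniteDimensional ℝ E]
    (hM : ∀ x y, inner ℝ (M x) y = inner ℝ x (M y)) (hM0 : ∀ x, 0 ≤ inner ℝ x (M x))
    (hc : 0 < c) (hg : Cocoercive c g) (hg0 : g 0 = 0) {α : ℝ} (hα : 0 < α) :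
    ∃ C r : ℝ, 0 < C ∧ 0 < r ∧ ∀ u w, IsDampedTrajectory M g u w →
      (∀ t, 0 ≤ t → α * ‖u t‖ ^ 2 ≤ inner ℝ (u t) (g (u t)) + inner ℝ (u t) (M (u t))) →
      ∀ t, 0 ≤ t → ‖u t‖ + ‖M (w t)‖ ≤ C * (‖u 0‖ + ‖M (w 0)‖) * Real.exp (-r * t) := by
  obtain ⟨κ, hκ, hκM⟩ := exists_inner_le_norm_sq hM
  obtain ⟨m, hm⟩ : ∃ m, m = ‖M‖ := ⟨_, rfl⟩
  have hm0 : 0 ≤ m := hm ▸ norm_nonneg _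
  obtain ⟨G, hG⟩ : ∃ G, G = c⁻¹ := ⟨_, rfl⟩
  have hG0 : 0 < G := hG ▸ inv_pos.2 hc
  -- By Young's inequality the cross term has derivative at most `q ‖u‖² - ‖M w‖² / 2`. Then `ε q ≤
  -- α / 2` spends only half the dissipation, and `ε (m + 1) ≤ 1 / 2` keeps the perturbed energy
  -- coercive. Below, `l` and `k` bound it from below and above, and `d` bounds its dissipation.
  obtain ⟨q, hq⟩ : ∃ q, q = (G + m) ^ 2 / 2 + m := ⟨_, rfl⟩
  have hq0 : 0 < q := by rw [hq]; positivity
  obtain ⟨ε, hε0, hε1, hε2⟩ : ∃ ε : ℝ, 0 < ε ∧ ε * q ≤ α / 2 ∧ ε ≤ 1 / (2 * (m + 1)) := by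
    refine ⟨min (α / (2 * q)) (1 / (2 * (m + 1))), by positivity, ?_, min_le_right _ _⟩
    calc min (α / (2 * q)) (1 / (2 * (m + 1))) * q ≤ α / (2 * q) * q := by
          gcongr; exact min_le_left _ _
      _ = α / 2 := by field_simp
  have hε3 : ε * (m + 1) ≤ 1 / 2 := by
    rw [le_div_iff₀ (by positivity)] at hε2
    linarith
  obtain ⟨l, hl⟩ : ∃ l : ℝ, l = 1 / (4 * (m + 1)) := ⟨_, rfl⟩
  have hl0 : 0 < l := by rw [hl]; positivity
  have hlm : l * (m + 1) = 1 / 4 := by rw [hl]; field_simp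
  obtain ⟨k, hk⟩ : ∃ k : ℝ, k = 1 / 2 + κ / 2 + ε := ⟨_, rfl⟩
  have hk0 : 0 < k := by rw [hk]; positivity
  obtain ⟨d, hd0, hd1, hd2⟩ : ∃ d : ℝ, 0 < d ∧ d ≤ α / 2 ∧ d ≤ ε / 2 :=
    ⟨min (α / 2) (ε / 2), by positivity, min_le_left _ _, min_le_right _ _⟩
  -- The square root and the halved rate come from passing from squared norms to norms; the `2` is
  -- from `add_sq_le`.
  refine ⟨√(2 * k / l), d / k / 2, by positivity, by positivity, fun u w h hco t ht => ?_⟩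
  have hCS : ∀ t, |inner ℝ (u t) (M (w t))| ≤ (‖u t‖ ^ 2 + ‖M (w t)‖ ^ 2) / 2 := fun t => by
    have := abs_real_inner_le_norm (u t) (M (w t))
    nlinarith [sq_nonneg (‖u t‖ - ‖M (w t)‖)]
  -- The energy alone dissipates nothing in `M w`; the derivative of the cross term supplies `-ε ‖M
  -- w‖²`.
  let W : ℝ → ℝ := fun t => energy M u w 0 t + ε * inner ℝ (u t) (M (w t))
  have hWlow : ∀ t, l * (‖u t‖ ^ 2 + ‖M (w t)‖ ^ 2) ≤ W t := by
    intro t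
    have h1 := norm_sq_le_of_psd hM hM0 (w t)
    rw [← hm] at h1
    have h2 := mul_le_mul_of_nonneg_left (neg_le_of_abs_le (hCS t)) hε0.le
    have h3 : l * ‖M (w t)‖ ^ 2 ≤ 1 / 4 * inner ℝ (w t) (M (w t)) := by
      rw [← hlm, mul_assoc]; gcongr
    have h4 : l ≤ 1 / 4 := by nlinarith
    have h5 : ε ≤ 1 / 2 := by nlinarith
    have h6 : l * ‖u t‖ ^ 2 ≤ 1 / 4 * ‖u t‖ ^ 2 := by gcongr
    have h7 : ε * ‖u t‖ ^ 2 ≤ 1 / 2 * ‖u t‖ ^ 2 := by gcongr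
    have h8 : ε * ‖M (w t)‖ ^ 2 ≤ 1 / 2 * inner ℝ (w t) (M (w t)) := by
      calc ε * ‖M (w t)‖ ^ 2 ≤ ε * ((m + 1) * inner ℝ (w t) (M (w t))) := by gcongr
        _ = ε * (m + 1) * inner ℝ (w t) (M (w t)) := by ring
        _ ≤ _ := mul_le_mul_of_nonneg_right hε3 (hM0 _)
    simp only [W, energy, sub_zero]
    linarith
  have hWup : ∀ t, W t ≤ k * (‖u t‖ ^ 2 + ‖M (w t)‖ ^ 2) := by
    intro t
    have h1 := hκM (w t)
    have h2 := mul_le_mul_of_nonneg_left (le_of_abs_le (hCS t)) hε0.le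
    have h6 : 0 ≤ ‖u t‖ ^ 2 := by positivity
    have h7 : 0 ≤ ‖M (w t)‖ ^ 2 := by positivity
    have h8 : 0 ≤ κ * ‖u t‖ ^ 2 := by positivity
    have h9 : 0 ≤ ε * ‖u t‖ ^ 2 := by positivity
    have h10 : 0 ≤ ε * ‖M (w t)‖ ^ 2 := by positivity
    simp only [W, energy, sub_zero, hk]
    linarith
  have hWd : ∀ t, 0 ≤ t → HasDerivWithinAt W
      (-(inner ℝ (u t - 0) (g (u t)) + inner ℝ (u t) (M (u t))) +
        ε * (inner ℝ (u t) (M (u t)) +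
          inner ℝ (-(g (u t) + M (u t) + M (w t))) (M (w t)))) (Set.Ici 0) t := fun t ht =>
    (h.hasDerivWithinAt_energy hM (map_zero M) ht).add
      (((h.deriv_velocity t ht).inner ℝ
        (M.hasFDerivAt.comp_hasDerivWithinAt t (h.deriv_position t ht))).const_mul ε)
  have hWneg : ∀ t, 0 ≤ t → -(inner ℝ (u t - 0) (g (u t)) + inner ℝ (u t) (M (u t))) +
        ε * (inner ℝ (u t) (M (u t)) +
          inner ℝ (-(g (u t) + M (u t) + M (w t))) (M (w t))) ≤ -(d / k) * W t := by
    intro t ht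
    have h1 := hco t ht
    have h2 : ‖g (u t)‖ ≤ G * ‖u t‖ := by
      have := hg.norm_sub_le hc (u t) 0
      rwa [hg0, sub_zero, sub_zero, ← hG] at this
    have h3 : ‖M (u t)‖ ≤ m * ‖u t‖ := hm ▸ M.le_opNorm (u t)
    have h4 : inner ℝ (u t) (M (u t)) ≤ m * ‖u t‖ ^ 2 := by
      calc _ ≤ ‖u t‖ * ‖M (u t)‖ := real_inner_le_norm _ _
        _ ≤ ‖u t‖ * (m * ‖u t‖) := by gcongr
        _ = _ := by ring
    have h5 : -inner ℝ (g (u t)) (M (w t)) ≤ G * ‖u t‖ * ‖M (w t)‖ := by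
      refine (neg_le_abs _).trans ((abs_real_inner_le_norm _ _).trans ?_)
      gcongr
    have h6 : -inner ℝ (M (u t)) (M (w t)) ≤ m * ‖u t‖ * ‖M (w t)‖ := by
      refine (neg_le_abs _).trans ((abs_real_inner_le_norm _ _).trans ?_)
      gcongr
    have h7 : (G + m) * ‖u t‖ * ‖M (w t)‖ ≤
        (G + m) ^ 2 / 2 * ‖u t‖ ^ 2 + ‖M (w t)‖ ^ 2 / 2 := by
      nlinarith [sq_nonneg ((G + m) * ‖u t‖ - ‖M (w t)‖)]
    have h8 : inner ℝ (u t) (M (u t)) + inner ℝ (-(g (u t) + M (u t) + M (w t))) (M (w t)) ≤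
        q * ‖u t‖ ^ 2 - ‖M (w t)‖ ^ 2 / 2 := by
      rw [inner_neg_left, inner_add_left, inner_add_left, real_inner_self_eq_norm_sq, hq]
      linarith
    have h9 := mul_le_mul_of_nonneg_left h8 hε0.le
    have h10 : d / k * W t ≤ d * (‖u t‖ ^ 2 + ‖M (w t)‖ ^ 2) := by
      calc d / k * W t ≤ d / k * (k * (‖u t‖ ^ 2 + ‖M (w t)‖ ^ 2)) := by gcongr; exact hWup t
        _ = d * (‖u t‖ ^ 2 + ‖M (w t)‖ ^ 2) := by field_simp
    have h11 : ε * q * ‖u t‖ ^ 2 ≤ α / 2 * ‖u t‖ ^ 2 := by gcongr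
    have h12 : d * ‖u t‖ ^ 2 ≤ α / 2 * ‖u t‖ ^ 2 := by gcongr
    have h13 : d * ‖M (w t)‖ ^ 2 ≤ ε / 2 * ‖M (w t)‖ ^ 2 := by gcongr
    rw [sub_zero, neg_mul]
    linarith
  have hdecay := le_mul_exp_of_hasDerivWithinAt hWd hWneg ht
  have hexp : Real.exp (-(d / k) * t) = Real.exp (-(d / k / 2) * t) ^ 2 := by
    rw [← Real.exp_nat_mul]; congr 1; push_cast; ring
  refine (sq_le_sq₀ (by positivity) (by positivity)).1 ?_
  rw [mul_pow, mul_pow, Real.sq_sqrt (by positivity), ← hexp]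
  have h1 : W 0 ≤ k * (‖u 0‖ + ‖M (w 0)‖) ^ 2 := by
    refine (hWup 0).trans ?_
    have h2 : 0 ≤ 2 * ‖u 0‖ * ‖M (w 0)‖ := by positivity
    rw [add_sq]
    gcongr
    linarith
  have h2 : (‖u t‖ + ‖M (w t)‖) ^ 2 ≤ 2 * (‖u t‖ ^ 2 + ‖M (w t)‖ ^ 2) :=
    add_sq_le
  have h3 : l * (‖u t‖ ^ 2 + ‖M (w t)‖ ^ 2) ≤
      k * (‖u 0‖ + ‖M (w 0)‖) ^ 2 * Real.exp (-(d / k) * t) :=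
    (hWlow t).trans (hdecay.trans (by gcongr))
  calc (‖u t‖ + ‖M (w t)‖) ^ 2 ≤ 2 / l * (l * (‖u t‖ ^ 2 + ‖M (w t)‖ ^ 2)) := by
        refine h2.trans (le_of_eq ?_); field_simp
    _ ≤ 2 / l * (k * (‖u 0‖ + ‖M (w 0)‖) ^ 2 * Real.exp (-(d / k) * t)) := by gcongr
    _ = 2 * k / l * (‖u 0‖ + ‖M (w 0)‖) ^ 2 * Real.exp (-(d / k) * t) := by ring

end Damped

/-! ### Convexity and cocoercivity of gradients -/

section Gradient

variable {E : Type*} [NormedAddCommGroup E] [InnerProductSpace ℝ E] [CompleteSpace E]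

/-- Derivative of a differentiable function along a line, in terms of the gradient. -/
theorem hasDerivAt_line {f : E → ℝ} (hd : Differentiable ℝ f) (x v : E) :
    HasDerivAt (fun s : ℝ => f (x + s • v)) (inner ℝ (gradient f x) v) 0 := by
  have h1 : HasDerivAt (fun s : ℝ => x + s • v) v 0 := by
    simpa using ((hasDerivAt_id (0 : ℝ)).smul_const v).const_add x
  have h2 : HasFDerivAt f (fderiv ℝ f x) (x + (0 : ℝ) • v) := by
    simpa using (hd x).hasFDerivAt
  rw [inner_gradient_left]
  exact h2.comp_hasDerivAt 0 h1

/-- The first-order characterization of convexity. -/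
theorem add_inner_gradient_le {f : E → ℝ} (hf : ConvexOn ℝ Set.univ f) (hd : Differentiable ℝ f)
    (x y : E) : f x + inner ℝ (gradient f x) (y - x) ≤ f y := by
  have h1 : ConvexOn ℝ Set.univ (fun s : ℝ => f (x + s • (y - x))) := by
    have := hf.comp_affineMap (AffineMap.lineMap (k := ℝ) x y)
    simpa [Function.comp_def, AffineMap.lineMap_apply, add_comm] using this
  have h2 := h1.le_slope_of_hasDerivAt (Set.mem_univ 0) (Set.mem_univ 1) one_pos
    (hasDerivAt_line hd x (y - x))
  simp only [slope_def_field, one_smul, zero_smul, add_zero, sub_zero, div_one,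
    add_sub_cancel] at h2
  linarith

/-- The gradient of a convex function with Lipschitz gradient is cocoercive. -/
theorem cocoercive_gradient {f : E → ℝ} (hf : ConvexOn ℝ Set.univ f) (hd : Differentiable ℝ f)
    {K : NNReal} (hK : LipschitzWith K (gradient f)) :
    Cocoercive (1 / (4 * ((K : ℝ) + 1))) (gradient f) := by
  intro x p
  -- The first-order inequalities along the cycle `p`, `x - s d`, `x`, `p` sum to cancel all
  -- function values. The gradient step `s` makes `K s ≤ 1 / 2`, so half of `s ‖d‖²` survives.
  obtain ⟨s, hs⟩ : ∃ s : ℝ, s = 1 / (2 * (K + 1)) := ⟨_, rfl⟩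
  have hs0 : 0 < s := by rw [hs]; positivity
  obtain ⟨d, hd'⟩ : ∃ d, d = gradient f x - gradient f p := ⟨_, rfl⟩
  have h1 := add_inner_gradient_le hf hd p (x - s • d)
  have h2 := add_inner_gradient_le hf hd (x - s • d) x
  have h3 := add_inner_gradient_le hf hd x p
  have h4 : -inner ℝ (gradient f (x - s • d) - gradient f x) d ≤ K * s * ‖d‖ ^ 2 := by
    refine (neg_le_abs _).trans ((abs_real_inner_le_norm _ _).trans ?_)
    have := hK.norm_sub_le (x - s • d) x
    rw [sub_sub_cancel_left, norm_neg, norm_smul, Real.norm_eq_abs, abs_of_pos hs0] at this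
    calc _ ≤ K * (s * ‖d‖) * ‖d‖ := by gcongr
      _ = _ := by ring
  have e1 : inner ℝ (gradient f p) (x - s • d - p) =
      inner ℝ (gradient f p) (x - p) - s * inner ℝ (gradient f p) d := by
    rw [sub_right_comm, inner_sub_right, inner_smul_right]
  have e2 : inner ℝ (gradient f (x - s • d)) (x - (x - s • d)) =
      s * inner ℝ (gradient f (x - s • d) - gradient f x) d + s * inner ℝ (gradient f x) d := by
    rw [sub_sub_cancel, inner_smul_right, inner_sub_left]; ring
  have e3 : inner ℝ (gradient f x) (p - x) = -inner ℝ (gradient f x) (x - p) := by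
    rw [← neg_sub x p, inner_neg_right]
  have e4 : inner ℝ (gradient f x) d - inner ℝ (gradient f p) d = ‖d‖ ^ 2 := by
    rw [← inner_sub_left, ← hd', real_inner_self_eq_norm_sq]
  have e5 : s * inner ℝ (gradient f x) d - s * inner ℝ (gradient f p) d = s * ‖d‖ ^ 2 := by
    rw [← e4]; ring
  have h5 := mul_le_mul_of_nonneg_left h4 hs0.le
  have h6 : s * (K * s * ‖d‖ ^ 2) ≤ s * ‖d‖ ^ 2 / 2 := by
    have : K * s ≤ 1 / 2 := by rw [hs]; field_simp; linarith
    calc s * (K * s * ‖d‖ ^ 2) ≤ s * (1 / 2 * ‖d‖ ^ 2) := by gcongr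
      _ = _ := by ring
  have h7 : 1 / (4 * ((K : ℝ) + 1)) * ‖d‖ ^ 2 = s * ‖d‖ ^ 2 / 2 := by
    rw [hs]; field_simp; ring
  rw [← hd', h7, hd', inner_sub_left, ← hd']
  rw [e1] at h1
  rw [e2] at h2
  rw [e3] at h3
  linarith

end Gradient

/-! ### From strong monotonicity on consensus vectors to coercivity -/

section CoerciveDissipation

variable {E : Type*} [NormedAddCommGroup E] [InnerProductSpace ℝ E]

/-- If a cocoercive map `N` is strongly monotone on a subspace that is approached by `u` at a rate
controlled by the quadratic form of `L`, then `⟪u, N u⟫ + ⟪u, L u⟫` dominates `‖u‖²`. -/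
theorem exists_mul_norm_sq_le_dissipation {L : E →L[ℝ] E} {N : E → E} {c C γ : ℝ} (hc : 0 < c)
    (hN : Cocoercive c N) (hN0 : N 0 = 0) (hC : 0 < C) (hγ : 0 < γ)
    (happ : ∀ u, ∃ v, ‖u - v‖ ^ 2 ≤ C * inner ℝ u (L u) ∧ γ * ‖v‖ ^ 2 ≤ inner ℝ v (N v)) :
    ∃ α : ℝ, 0 < α ∧ ∀ u, α * ‖u‖ ^ 2 ≤ inner ℝ u (N u) + inner ℝ u (L u) := by
  obtain ⟨β, hβ⟩ : ∃ β, β = γ⁻¹ := ⟨_, rfl⟩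
  have hβ0 : 0 < β := hβ ▸ inv_pos.2 hγ
  obtain ⟨G, hG⟩ : ∃ G, G = c⁻¹ := ⟨_, rfl⟩
  have hG0 : 0 < G := hG ▸ inv_pos.2 hc
  obtain ⟨κ, hκ⟩ : ∃ κ, κ = 2 * (β ^ 2 * G) + 2 * ((β * G + 1) ^ 2 * C) := ⟨_, rfl⟩
  have hκ0 : 0 < κ := by rw [hκ]; positivity
  refine ⟨κ⁻¹, inv_pos.2 hκ0, fun u => ?_⟩
  obtain ⟨v, hv1, hv2⟩ := happ u
  have hS : ‖N u‖ ^ 2 ≤ G * inner ℝ u (N u) := by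
    have := hN u 0
    rw [hN0, sub_zero, sub_zero, real_inner_comm] at this
    rwa [hG, inv_mul_eq_div, le_div_iff₀' hc]
  -- Strong monotonicity gives `γ ‖v‖ ≤ ‖N v‖`, and the Lipschitz bound moves `N v` to `N u`. Thus
  -- `‖u‖` is bounded by `‖N u‖` and `‖u - v‖`, whose squares are each controlled by one term of the
  -- dissipation.
  have hv3 : ‖v‖ ≤ β * (‖N u‖ + G * ‖u - v‖) := by
    rw [hβ, inv_mul_eq_div, le_div_iff₀' hγ]
    rcases eq_or_ne v 0 with rfl | hv
    · simp only [norm_zero, mul_zero]; positivity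
    · refine le_of_mul_le_mul_right ?_ (norm_pos_iff.2 hv)
      have h1 : ‖N v‖ ≤ ‖N u‖ + G * ‖u - v‖ := by
        have h2 := hN.norm_sub_le hc v u
        rw [← hG, norm_sub_rev v u] at h2
        have h3 := norm_add_le (N u) (N v - N u)
        rw [add_sub_cancel] at h3
        linarith
      calc γ * ‖v‖ * ‖v‖ = γ * ‖v‖ ^ 2 := by ring
        _ ≤ ‖v‖ * ‖N v‖ := hv2.trans (real_inner_le_norm _ _)
        _ ≤ ‖v‖ * (‖N u‖ + G * ‖u - v‖) := by gcongr
        _ = _ := mul_comm _ _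
  have hu : ‖u‖ ≤ β * ‖N u‖ + (β * G + 1) * ‖u - v‖ := by
    have := norm_add_le v (u - v)
    rw [add_sub_cancel] at this
    linarith
  rw [inv_mul_eq_div, div_le_iff₀' hκ0]
  have hS0 : 0 ≤ inner ℝ u (N u) := nonneg_of_mul_nonneg_right ((sq_nonneg _).trans hS) hG0
  have hQ0 : 0 ≤ inner ℝ u (L u) := nonneg_of_mul_nonneg_right ((sq_nonneg _).trans hv1) hC
  calc ‖u‖ ^ 2 ≤ (β * ‖N u‖ + (β * G + 1) * ‖u - v‖) ^ 2 := by gcongr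
    _ ≤ 2 * ((β * ‖N u‖) ^ 2 + ((β * G + 1) * ‖u - v‖) ^ 2) := add_sq_le
    _ = 2 * (β ^ 2 * ‖N u‖ ^ 2) + 2 * ((β * G + 1) ^ 2 * ‖u - v‖ ^ 2) := by ring
    _ ≤ 2 * (β ^ 2 * (G * inner ℝ u (N u))) +
        2 * ((β * G + 1) ^ 2 * (C * inner ℝ u (L u))) := by gcongr
    _ = 2 * (β ^ 2 * G) * inner ℝ u (N u) + 2 * ((β * G + 1) ^ 2 * C) * inner ℝ u (L u) := by ring
    _ ≤ κ * inner ℝ u (N u) + κ * inner ℝ u (L u) := by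
      gcongr
      · rw [hκ]; exact le_add_of_nonneg_right (by positivity)
      · rw [hκ]; exact le_add_of_nonneg_left (by positivity)
    _ = κ * (inner ℝ u (N u) + inner ℝ u (L u)) := by ring

end CoerciveDissipation

/-! ### Primitives and constant functions on the half-line -/

open Set in
/-- The integral of a continuous function on `[0, ∞)` is a primitive on `[0, ∞)`. -/
theorem hasDerivWithinAt_integral_Ici {E : Type*} [NormedAddCommGroup E] [NormedSpace ℝ E]
    [CompleteSpace E] {φ : ℝ → E} (hφ : ContinuousOn φ (Ici 0)) {t : ℝ} (ht : 0 ≤ t) :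
    HasDerivWithinAt (fun t => ∫ s in (0 : ℝ)..t, φ s) (φ t) (Ici 0) t := by
  -- Constant extension to negative times makes the two-sided fundamental theorem available at `t =
  -- 0`.
  have hc : Continuous fun s => φ (max s 0) :=
    hφ.comp_continuous (by fun_prop) fun s => mem_Ici.2 (le_max_right s 0)
  have h1 := (hc.integral_hasStrictDerivAt 0 t).hasDerivAt.hasDerivWithinAt (s := Ici 0)
  rw [max_eq_left ht] at h1
  have key : ∀ r ∈ Ici (0 : ℝ), ∫ s in (0 : ℝ)..r, φ s = ∫ s in (0 : ℝ)..r, φ (max s 0) := by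
    intro r hr
    refine intervalIntegral.integral_congr fun s hs => ?_
    rw [uIcc_of_le hr] at hs
    simp only [max_eq_left hs.1]
  exact h1.congr key (key t ht)

open Set in
/-- A function on `[0, ∞)` with zero derivative is constant. -/
theorem eq_of_hasDerivWithinAt_zero {E : Type*} [NormedAddCommGroup E] [NormedSpace ℝ E]
    {φ : ℝ → E} (hφ : ∀ t, 0 ≤ t → HasDerivWithinAt φ 0 (Ici 0) t) {t : ℝ} (ht : 0 ≤ t) :
    φ t = φ 0 := by
  have := Convex.norm_image_sub_le_of_norm_hasDerivWithin_le (𝕜 := ℝ) (C := 0)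
    (fun t ht => hφ t ht) (fun _ _ => by simp) (convex_Ici 0) (mem_Ici.2 le_rfl) ht
  rw [zero_mul] at this
  exact sub_eq_zero.1 (norm_le_zero_iff.1 this)

/-! ### The stacked space and the graph Laplacian -/

section Laplacian

variable {ι : Type*} {n : ℕ}

/-- The stacked space of all local variables, with its Euclidean norm. -/
def Stacked (ι : Type*) (n : ℕ) : Type _ := PiLp 2 fun _ : ι => EuclideanSpace ℝ (Fin n)

instance : CoeFun (Stacked ι n) fun _ => ι → EuclideanSpace ℝ (Fin n) := ⟨WithLp.ofLp⟩

/-- The stacked vector with given components. -/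
def stack (z : ι → EuclideanSpace ℝ (Fin n)) : Stacked ι n := WithLp.toLp 2 z

@[simp] theorem stack_apply (z : ι → EuclideanSpace ℝ (Fin n)) (i : ι) : stack z i = z i := rfl

theorem Stacked.ext {u v : Stacked ι n} (h : ∀ i, u i = v i) : u = v :=
  WithLp.ofLp_injective 2 (funext h)

/-- The consensus vector all of whose components are `a`. -/
def consensus (ι : Type*) {n : ℕ} (a : EuclideanSpace ℝ (Fin n)) : Stacked ι n := stack fun _ => a

@[simp] theorem consensus_apply (a : EuclideanSpace ℝ (Fin n)) (i : ι) : consensus ι a i = a := rfl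

variable [Fintype ι]

noncomputable instance : NormedAddCommGroup (Stacked ι n) :=
  inferInstanceAs (NormedAddCommGroup (PiLp 2 fun _ : ι => EuclideanSpace ℝ (Fin n)))

noncomputable instance : InnerProductSpace ℝ (Stacked ι n) :=
  inferInstanceAs (InnerProductSpace ℝ (PiLp 2 fun _ : ι => EuclideanSpace ℝ (Fin n)))

instance : FiniteDimensional ℝ (Stacked ι n) :=
  inferInstanceAs (FiniteDimensional ℝ (PiLp 2 fun _ : ι => EuclideanSpace ℝ (Fin n)))

@[simp] theorem Stacked.add_apply (u v : Stacked ι n) (i : ι) : (u + v) i = u i + v i := rfl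

@[simp] theorem Stacked.sub_apply (u v : Stacked ι n) (i : ι) : (u - v) i = u i - v i := rfl

@[simp] theorem Stacked.zero_apply (i : ι) : (0 : Stacked ι n) i = 0 := rfl

/-- Stacking as a linear map. -/
def stackLinear : (ι → EuclideanSpace ℝ (Fin n)) →ₗ[ℝ] Stacked ι n where
  toFun := stack
  map_add' _ _ := rfl
  map_smul' _ _ := rfl

/-- The components of a stacked vector as a linear map. -/
def unstackLinear : Stacked ι n →ₗ[ℝ] (ι → EuclideanSpace ℝ (Fin n)) where
  toFun u := u
  map_add' _ _ := rfl
  map_smul' _ _ := rfl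

/-- A linear map applied to each block. -/
noncomputable def blockMap (T : ι → EuclideanSpace ℝ (Fin n) →L[ℝ] EuclideanSpace ℝ (Fin n)) :
    Stacked ι n →L[ℝ] Stacked ι n :=
  LinearMap.toContinuousLinearMap (stackLinear ∘ₗ
    LinearMap.pi (fun i => (T i).toLinearMap ∘ₗ LinearMap.proj i) ∘ₗ unstackLinear)

theorem inner_stacked (u v : Stacked ι n) : inner ℝ u v = ∑ i, inner ℝ (u i) (v i) :=
  PiLp.inner_apply u v

theorem norm_sq_stacked (u : Stacked ι n) : ‖u‖ ^ 2 = ∑ i, ‖u i‖ ^ 2 :=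
  PiLp.norm_sq_eq_of_L2 _ u

theorem norm_sq_consensus (a : EuclideanSpace ℝ (Fin n)) :
    ‖consensus ι a‖ ^ 2 = Fintype.card ι * ‖a‖ ^ 2 := by
  rw [norm_sq_stacked]
  simp

theorem norm_le_sum_norm (u : Stacked ι n) : ‖u‖ ≤ ∑ i, ‖u i‖ := by
  refine (sq_le_sq₀ (norm_nonneg _) (by positivity)).1 ?_
  rw [norm_sq_stacked]
  exact Finset.sum_sq_le_sq_sum_of_nonneg fun _ _ => norm_nonneg _

theorem sum_norm_le (u : Stacked ι n) : ∑ i, ‖u i‖ ≤ Fintype.card ι * ‖u‖ := by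
  calc ∑ i, ‖u i‖ ≤ ∑ _i : ι, ‖u‖ := Finset.sum_le_sum fun i _ => PiLp.norm_apply_le u i
    _ = _ := by simp

variable (G : SimpleGraph ι) [DecidableRel G.Adj]

/-- The disagreement as a linear map on tuples. -/
noncomputable def disagreementMap :
    (ι → EuclideanSpace ℝ (Fin n)) →ₗ[ℝ] (ι → EuclideanSpace ℝ (Fin n)) where
  toFun := disagreement G
  map_add' u v := by
    ext1 i
    simp only [disagreement, Pi.add_apply, ← Finset.sum_add_distrib]
    exact Finset.sum_congr rfl fun j _ => by abel
  map_smul' c u := by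
    ext1 i
    simp only [disagreement, Pi.smul_apply, ← smul_sub, ← Finset.smul_sum, RingHom.id_apply]

theorem disagreement_sub_const (z : ι → EuclideanSpace ℝ (Fin n)) (p : EuclideanSpace ℝ (Fin n)) :
    disagreement G (fun i => z i - p) = disagreement G z := by
  ext1 i
  simp [disagreement]

/-- The graph Laplacian on the stacked space. -/
noncomputable def laplacian : Stacked ι n →L[ℝ] Stacked ι n :=
  LinearMap.toContinuousLinearMap (stackLinear ∘ₗ disagreementMap G ∘ₗ unstackLinear)

theorem laplacian_apply (u : Stacked ι n) (i : ι) :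
    laplacian G u i = disagreement G (fun j => u j) i := rfl

/-- Averaging the sum over ordered edges with its copy under `i ↔ j` gives this form, from which
symmetry and positivity are immediate. -/
theorem inner_laplacian (u v : Stacked ι n) :
    inner ℝ (laplacian G u) v =
      (1 / 2) * ∑ i, ∑ j, if G.Adj i j then inner ℝ (u i - u j) (v i - v j) else 0 := by
  have h1 : inner ℝ (laplacian G u) v =
      ∑ i, ∑ j, if G.Adj i j then inner ℝ (u i - u j) (v i) else 0 := by
    rw [inner_stacked]
    refine Finset.sum_congr rfl fun i _ => ?_
    rw [laplacian_apply, disagreement, sum_inner, ← Finset.sum_filter]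
    refine Finset.sum_congr ?_ fun _ _ => rfl
    ext j
    simp
  have h2 : inner ℝ (laplacian G u) v =
      ∑ i, ∑ j, if G.Adj i j then -inner ℝ (u i - u j) (v j) else 0 := by
    rw [h1, Finset.sum_comm]
    refine Finset.sum_congr rfl fun i _ => Finset.sum_congr rfl fun j _ => ?_
    simp only [G.adj_comm j i, ← inner_neg_left, neg_sub]
  have h3 : inner ℝ (laplacian G u) v + inner ℝ (laplacian G u) v =
      ∑ i, ∑ j, if G.Adj i j then inner ℝ (u i - u j) (v i - v j) else 0 := by
    nth_rw 1 [h1]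
    rw [h2, ← Finset.sum_add_distrib]
    refine Finset.sum_congr rfl fun i _ => ?_
    rw [← Finset.sum_add_distrib]
    refine Finset.sum_congr rfl fun j _ => ?_
    split_ifs
    · rw [inner_sub_right (u i - u j)]; ring
    · ring
  linarith

theorem laplacian_symmetric (u v : Stacked ι n) :
    inner ℝ (laplacian G u) v = inner ℝ u (laplacian G v) := by
  rw [real_inner_comm (laplacian G v) u, inner_laplacian, inner_laplacian]
  simp only [real_inner_comm]

theorem inner_laplacian_nonneg (u : Stacked ι n) : 0 ≤ inner ℝ u (laplacian G u) := by
  rw [← laplacian_symmetric, inner_laplacian]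
  refine mul_nonneg (by norm_num) (Finset.sum_nonneg fun i _ => Finset.sum_nonneg fun j _ => ?_)
  split_ifs
  · exact real_inner_self_nonneg
  · exact le_rfl

variable {G}

/-- On a connected graph, the Laplacian vanishes only on consensus vectors. -/
theorem exists_eq_consensus (hG : G.Connected) {u : Stacked ι n}
    (hu : inner ℝ u (laplacian G u) = 0) : ∃ a, u = consensus ι a := by
  have hnn : ∀ i j, 0 ≤ if G.Adj i j then inner ℝ (u i - u j) (u i - u j) else (0 : ℝ) := by
    intro i j
    split_ifs
    · exact real_inner_self_nonneg
    · exact le_rfl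
  have hadj : ∀ i j, G.Adj i j → u i = u j := by
    intro i j hij
    rw [← laplacian_symmetric, inner_laplacian, mul_eq_zero, or_iff_right (by norm_num),
      Finset.sum_eq_zero_iff_of_nonneg fun i _ => Finset.sum_nonneg fun j _ => hnn i j] at hu
    have h1 := hu i (Finset.mem_univ i)
    rw [Finset.sum_eq_zero_iff_of_nonneg fun j _ => hnn i j] at h1
    have h2 := h1 j (Finset.mem_univ j)
    rw [if_pos hij, inner_self_eq_zero] at h2
    exact sub_eq_zero.1 h2
  obtain ⟨i₀⟩ := hG.nonempty
  refine ⟨u i₀, ?_⟩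
  refine Stacked.ext fun i => ?_
  obtain ⟨p⟩ := hG.preconnected i i₀
  rw [consensus_apply]
  induction p with
  | nil => rfl
  | cons h _ ih => exact (hadj _ _ h).trans ih

/-- On a connected graph, the distance to consensus is controlled by the Laplacian form. -/
theorem exists_consensus_norm_sub_sq_le (hG : G.Connected) :
    ∃ C : ℝ, 0 < C ∧ ∀ u : Stacked ι n, ∃ a,
      ‖u - consensus ι a‖ ^ 2 ≤ C * inner ℝ u (laplacian G u) := by
  obtain ⟨C, hC, h⟩ := exists_preimage_norm_le_of_finiteDimensional (laplacian (n := n) G)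
  refine ⟨C ^ 2 * (‖laplacian (n := n) G‖ + 1), by positivity, fun u => ?_⟩
  obtain ⟨y, hy, hyn⟩ := h u
  -- `y` is a short vector with the same Laplacian as `u`, so `u - y` is a consensus vector.
  obtain ⟨a, ha⟩ := exists_eq_consensus hG (u := u - y) (by rw [map_sub, hy, sub_self,
    inner_zero_right])
  refine ⟨a, ?_⟩
  rw [← ha, sub_sub_cancel]
  calc ‖y‖ ^ 2 ≤ (C * ‖laplacian G u‖) ^ 2 := by gcongr
    _ = C ^ 2 * ‖laplacian G u‖ ^ 2 := mul_pow _ _ _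
    _ ≤ C ^ 2 * ((‖laplacian (n := n) G‖ + 1) * inner ℝ u (laplacian G u)) := by
      gcongr
      exact norm_sq_le_of_psd (laplacian_symmetric G) (inner_laplacian_nonneg G) u
    _ = _ := by ring

end Laplacian

/-! ### Blockwise projection and the compressed Laplacian -/

section Projection

variable {ι : Type*} [Fintype ι] {n : ℕ} {k : ι → ℕ}
  (A : (i : ι) → Matrix (Fin (k i)) (Fin n) ℝ)

/-- The orthogonal projection of the stacked space onto the product of the kernels. -/
noncomputable def stackedProj : Stacked ι n →L[ℝ] Stacked ι n := blockMap fun i => kerProj (A i)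

theorem stackedProj_apply (u : Stacked ι n) (i : ι) :
    stackedProj A u i = kerProj (A i) (u i) := rfl

theorem kerProj_eq_self_iff {m : ℕ} {B : Matrix (Fin m) (Fin n) ℝ}
    {v : EuclideanSpace ℝ (Fin n)} : kerProj B v = v ↔ Matrix.toEuclideanLin B v = 0 :=
  Submodule.starProjection_eq_self_iff

theorem kerProj_kerProj {m : ℕ} (B : Matrix (Fin m) (Fin n) ℝ) (v : EuclideanSpace ℝ (Fin n)) :
    kerProj B (kerProj B v) = kerProj B v :=
  Submodule.starProjection_eq_self_iff.2 (Submodule.starProjection_apply_mem _ v)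

theorem stackedProj_stackedProj (u : Stacked ι n) :
    stackedProj A (stackedProj A u) = stackedProj A u := by
  refine Stacked.ext fun i => ?_
  exact kerProj_kerProj (A i) (u i)

theorem stackedProj_consensus_eq_self_iff {a : EuclideanSpace ℝ (Fin n)} :
    stackedProj A (consensus ι a) = consensus ι a ↔
      ∀ i, Matrix.toEuclideanLin (A i) a = 0 := by
  simp only [← kerProj_eq_self_iff]
  constructor
  · intro h i
    exact congrArg (fun u : Stacked ι n => u i) h
  · intro h
    refine Stacked.ext fun i => ?_
    exact h i

theorem stackedProj_symmetric (u v : Stacked ι n) :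
    inner ℝ (stackedProj A u) v = inner ℝ u (stackedProj A v) := by
  simp only [inner_stacked, stackedProj_apply]
  exact Finset.sum_congr rfl fun i _ => Submodule.inner_starProjection_left_eq_right _ _ _

theorem norm_stackedProj_le (u : Stacked ι n) : ‖stackedProj A u‖ ≤ ‖u‖ := by
  have h : ‖stackedProj A u‖ * ‖stackedProj A u‖ ≤ ‖u‖ * ‖stackedProj A u‖ := by
    rw [← real_inner_self_eq_norm_mul_norm, stackedProj_symmetric, stackedProj_stackedProj]
    exact real_inner_le_norm _ _
  rcases (norm_nonneg (stackedProj A u)).eq_or_lt with h0 | h0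
  · rw [← h0]; exact norm_nonneg _
  · exact le_of_mul_le_mul_right h h0

variable (G : SimpleGraph ι) [DecidableRel G.Adj]

/-- The Laplacian compressed to the product of the kernels. -/
noncomputable def projLaplacian : Stacked ι n →L[ℝ] Stacked ι n :=
  stackedProj A ∘L laplacian G ∘L stackedProj A

theorem projLaplacian_apply (u : Stacked ι n) :
    projLaplacian A G u = stackedProj A (laplacian G (stackedProj A u)) := rfl

theorem inner_projLaplacian (u v : Stacked ι n) :
    inner ℝ u (projLaplacian A G v) = inner ℝ (stackedProj A u) (laplacian G (stackedProj A v)) := by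
  rw [projLaplacian_apply, stackedProj_symmetric]

theorem projLaplacian_symmetric (u v : Stacked ι n) :
    inner ℝ (projLaplacian A G u) v = inner ℝ u (projLaplacian A G v) := by
  rw [real_inner_comm, inner_projLaplacian, inner_projLaplacian, ← laplacian_symmetric,
    real_inner_comm]

theorem inner_projLaplacian_nonneg (u : Stacked ι n) : 0 ≤ inner ℝ u (projLaplacian A G u) := by
  rw [inner_projLaplacian]
  exact inner_laplacian_nonneg G _

variable {G}

theorem exists_stackedProj_eq_consensus (hG : G.Connected) {u : Stacked ι n}
    (hu : projLaplacian A G u = 0) : ∃ a, stackedProj A u = consensus ι a :=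
  exists_eq_consensus hG (by rw [← inner_projLaplacian, hu, inner_zero_right])

end Projection

/-! ### First-order optimality conditions -/

section Optimality

variable {ι : Type*} [Fintype ι] {n : ℕ} {k : ι → ℕ}
  {f : ι → EuclideanSpace ℝ (Fin n) → ℝ} {A : (i : ι) → Matrix (Fin (k i)) (Fin n) ℝ}
  {b : (i : ι) → EuclideanSpace ℝ (Fin (k i))}

/-- First-order optimality conditions, necessity. -/
theorem IsOptimal.sum_inner_gradient_eq_zero (hd : ∀ i, Differentiable ℝ (f i))
    {p : EuclideanSpace ℝ (Fin n)} (hp : IsOptimal f A b fun _ => p) {v : EuclideanSpace ℝ (Fin n)}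
    (hv : ∀ i, Matrix.toEuclideanLin (A i) v = 0) : ∑ i, inner ℝ (gradient (f i) p) v = 0 := by
  have h1 : HasDerivAt (fun s : ℝ => ∑ i, f i (p + s • v)) (∑ i, inner ℝ (gradient (f i) p) v) 0 :=
    HasDerivAt.fun_sum fun i _ => hasDerivAt_line (hd i) p v
  refine IsLocalMin.hasDerivAt_eq_zero (Filter.Eventually.of_forall fun s => ?_) h1
  simp only [zero_smul, add_zero]
  exact hp.2 (fun _ => p + s • v) ⟨fun i => by simp [hp.1.1 i, hv i], fun _ _ => rfl⟩

/-- First-order optimality conditions, sufficiency. -/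
theorem isOptimal_of_sum_inner_gradient_eq_zero [Nonempty ι]
    (hconv : ∀ i, ConvexOn ℝ Set.univ (f i)) (hd : ∀ i, Differentiable ℝ (f i))
    {p : EuclideanSpace ℝ (Fin n)} (hp : ∀ i, Matrix.toEuclideanLin (A i) p = b i)
    (h : ∀ v, (∀ i, Matrix.toEuclideanLin (A i) v = 0) →
      ∑ i, inner ℝ (gradient (f i) p) v = 0) : IsOptimal f A b fun _ => p := by
  refine ⟨⟨hp, fun _ _ => rfl⟩, fun w hw => ?_⟩
  obtain ⟨i₀⟩ := ‹Nonempty ι›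
  have h1 : ∀ i, w i = w i₀ := fun i => hw.2 i i₀
  have h2 := h (w i₀ - p) fun i => by rw [map_sub, hp i, ← h1 i, hw.1 i, sub_self]
  calc ∑ i, f i p = ∑ i, (f i p + inner ℝ (gradient (f i) p) (w i₀ - p)) := by
        rw [Finset.sum_add_distrib, h2, add_zero]
    _ ≤ ∑ i, f i (w i) := Finset.sum_le_sum fun i _ => by
        rw [h1 i]; exact add_inner_gradient_le (hconv i) (hd i) p (w i₀)

end Optimality

/-! ### Cocoercivity of the stacked gradient differences -/

section GradientGap

variable {ι : Type*} {n : ℕ}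

/-- The stacked vector of differences `∇ f i (p + u i) - ∇ f i p`. -/
noncomputable def gradientGap (f : ι → EuclideanSpace ℝ (Fin n) → ℝ)
    (p : EuclideanSpace ℝ (Fin n)) (u : Stacked ι n) : Stacked ι n :=
  stack fun i => gradient (f i) (p + u i) - gradient (f i) p

/-- The stacked vector of the gradients at `p`. -/
noncomputable def stackedGradient (f : ι → EuclideanSpace ℝ (Fin n) → ℝ)
    (p : EuclideanSpace ℝ (Fin n)) : Stacked ι n :=
  stack fun i => gradient (f i) p

theorem gradientGap_apply (f : ι → EuclideanSpace ℝ (Fin n) → ℝ) (p : EuclideanSpace ℝ (Fin n))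
    (u : Stacked ι n) (i : ι) :
    gradientGap f p u i = gradient (f i) (p + u i) - gradient (f i) p := rfl

variable [Fintype ι]

theorem gradientGap_zero (f : ι → EuclideanSpace ℝ (Fin n) → ℝ) (p : EuclideanSpace ℝ (Fin n)) :
    gradientGap f p 0 = 0 := by
  refine Stacked.ext fun i => ?_
  simp [gradientGap_apply]

/-- The gradient differences compressed to the product of the kernels. -/
noncomputable def projGradientGap {k : ι → ℕ} (f : ι → EuclideanSpace ℝ (Fin n) → ℝ)
    (A : (i : ι) → Matrix (Fin (k i)) (Fin n) ℝ) (p : EuclideanSpace ℝ (Fin n))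
    (u : Stacked ι n) : Stacked ι n :=
  stackedProj A (gradientGap f p (stackedProj A u))

theorem projGradientGap_zero {k : ι → ℕ} (f : ι → EuclideanSpace ℝ (Fin n) → ℝ)
    (A : (i : ι) → Matrix (Fin (k i)) (Fin n) ℝ) (p : EuclideanSpace ℝ (Fin n)) :
    projGradientGap f A p 0 = 0 := by
  rw [projGradientGap, map_zero, gradientGap_zero, map_zero]

variable {f : ι → EuclideanSpace ℝ (Fin n) → ℝ}

theorem exists_cocoercive_gradientGap (hconv : ∀ i, ConvexOn ℝ Set.univ (f i))
    (hd : ∀ i, Differentiable ℝ (f i))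
    (hLip : ∀ i, ∃ K : NNReal, LipschitzWith K (gradient (f i))) :
    ∃ c : ℝ, 0 < c ∧ ∀ p, Cocoercive c (gradientGap f p) := by
  choose K hK using hLip
  refine ⟨1 / (4 * (((∑ i, K i : NNReal) : ℝ) + 1)), by positivity, fun p u v => ?_⟩
  rw [norm_sq_stacked, inner_stacked, Finset.mul_sum]
  refine Finset.sum_le_sum fun i _ => ?_
  have h := cocoercive_gradient (hconv i) (hd i) ((hK i).weaken
    (Finset.single_le_sum (fun _ _ => bot_le) (Finset.mem_univ i))) (p + u i) (p + v i)
  rw [add_sub_add_left_eq_sub] at h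
  simpa only [Stacked.sub_apply, gradientGap_apply, sub_sub_sub_cancel_right] using h

/-- Symmetry moves the outer `P` onto the increment, and contractivity only shrinks the left side.
-/
theorem Cocoercive.comp_projection {E : Type*} [NormedAddCommGroup E] [InnerProductSpace ℝ E]
    {P : E →L[ℝ] E} {N : E → E} {c : ℝ} (hc : 0 < c) (h : Cocoercive c N)
    (hP : ∀ u v, inner ℝ (P u) v = inner ℝ u (P v)) (hP1 : ∀ u, ‖P u‖ ≤ ‖u‖) :
    Cocoercive c fun u => P (N (P u)) := by
  intro u v
  have h1 := h (P u) (P v)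
  simp only [← map_sub] at h1 ⊢
  rw [hP]
  refine le_trans ?_ h1
  gcongr
  exact hP1 _

theorem cocoercive_projGradientGap {k : ι → ℕ} {A : (i : ι) → Matrix (Fin (k i)) (Fin n) ℝ} {c : ℝ}
    (hc : 0 < c) {p : EuclideanSpace ℝ (Fin n)} (h : Cocoercive c (gradientGap f p)) :
    Cocoercive c (projGradientGap f A p) :=
  h.comp_projection hc (stackedProj_symmetric A) (norm_stackedProj_le A)

end GradientGap

/-! ### Trajectories as damped oscillators -/

section Trajectory

variable {ι : Type*} [Fintype ι] {n : ℕ} {k : ι → ℕ}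
  {G : SimpleGraph ι} [DecidableRel G.Adj] {f : ι → EuclideanSpace ℝ (Fin n) → ℝ}
  {A : (i : ι) → Matrix (Fin (k i)) (Fin n) ℝ} {b : (i : ι) → EuclideanSpace ℝ (Fin (k i))}

theorem hasDerivWithinAt_stack {z : ℝ → ι → EuclideanSpace ℝ (Fin n)}
    {z' : ι → EuclideanSpace ℝ (Fin n)} {s : Set ℝ} {t : ℝ}
    (h : ∀ i, HasDerivWithinAt (fun r => z r i) (z' i) s t) :
    HasDerivWithinAt (fun r => stack (z r)) (stack z') s t :=
  (LinearMap.toContinuousLinearMap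
    (stackLinear (ι := ι) (n := n))).hasFDerivAt.comp_hasDerivWithinAt t (hasDerivWithinAt_pi.2 h)

/-- The stacked tracking error relative to `p`. -/
noncomputable def trackingError (x : ℝ → ι → EuclideanSpace ℝ (Fin n))
    (p : EuclideanSpace ℝ (Fin n)) (t : ℝ) : Stacked ι n :=
  stack fun i => x t i - p

/-- The stacked integral feedback terms. -/
noncomputable def stackedIntegral (G : SimpleGraph ι) [DecidableRel G.Adj]
    (x : ℝ → ι → EuclideanSpace ℝ (Fin n)) (t : ℝ) : Stacked ι n :=
  stack fun i => integralTerm G x i t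

theorem IsTrajectory.hasDerivWithinAt_trackingError
    {x : ℝ → ι → EuclideanSpace ℝ (Fin n)} (hx : IsTrajectory G f A b x)
    (p : EuclideanSpace ℝ (Fin n)) {t : ℝ} (ht : 0 ≤ t) :
    HasDerivWithinAt (trackingError x p)
      (-(stackedProj A (gradientGap f p (trackingError x p t) + laplacian G (trackingError x p t) +
        (stackedIntegral G x t + stackedGradient f p)))) (Set.Ici 0) t := by
  refine (hasDerivWithinAt_stack fun i => (hx.2 t ht i).sub_const p).congr_deriv ?_
  refine Stacked.ext fun i => ?_
  change -(kerProj (A i) _) = -(kerProj (A i) ((gradient (f i) (p + (x t i - p)) -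
    gradient (f i) p) + disagreement G (fun j => x t j - p) i +
      (integralTerm G x i t + gradient (f i) p)))
  rw [disagreement_sub_const, add_sub_cancel]
  congr 2
  abel

/-- The affine constraints are invariant along trajectories. -/
theorem IsTrajectory.stackedProj_trackingError
    {x : ℝ → ι → EuclideanSpace ℝ (Fin n)} (hx : IsTrajectory G f A b x)
    {p : EuclideanSpace ℝ (Fin n)} (hp : ∀ i, Matrix.toEuclideanLin (A i) p = b i) {t : ℝ}
    (ht : 0 ≤ t) : stackedProj A (trackingError x p t) = trackingError x p t := by
  have h0 : stackedProj A (trackingError x p 0) = trackingError x p 0 := by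
    refine Stacked.ext fun i => ?_
    refine kerProj_eq_self_iff.2 ?_
    change Matrix.toEuclideanLin (A i) (x 0 i - p) = 0
    rw [map_sub, hx.1 i, hp i, sub_self]
  have h1 := eq_of_hasDerivWithinAt_zero
    (φ := fun t => stackedProj A (trackingError x p t) - trackingError x p t) (fun t ht => by
      have h := hx.hasDerivWithinAt_trackingError p ht
      refine (((stackedProj A).hasFDerivAt.comp_hasDerivWithinAt t h).sub h).congr_deriv ?_
      rw [map_neg, stackedProj_stackedProj, sub_self]) ht
  simp only [h0, sub_self] at h1
  exact sub_eq_zero.1 h1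

theorem IsTrajectory.hasDerivWithinAt_stackedIntegral
    {x : ℝ → ι → EuclideanSpace ℝ (Fin n)} (hx : IsTrajectory G f A b x)
    (p : EuclideanSpace ℝ (Fin n)) {t : ℝ} (ht : 0 ≤ t) :
    HasDerivWithinAt (stackedIntegral G x) (laplacian G (trackingError x p t)) (Set.Ici 0) t := by
  have hcont : ∀ i, ContinuousOn (fun s => x s i) (Set.Ici 0) := fun i s hs =>
    (hx.2 s hs i).continuousWithinAt
  refine (hasDerivWithinAt_stack fun i => hasDerivWithinAt_integral_Ici
    (φ := fun s => disagreement G (x s) i) ?_ ht).congr_deriv ?_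
  · exact continuousOn_finsetSum _ fun j _ => (hcont i).sub (hcont j)
  · refine Stacked.ext fun i => ?_
    exact (congrFun (disagreement_sub_const G (x t) p) i).symm

/-- The tracking error of a trajectory is the velocity of a damped trajectory whose elastic force
is the projected integral feedback. -/
theorem IsTrajectory.exists_isDampedTrajectory
    {x : ℝ → ι → EuclideanSpace ℝ (Fin n)} (hx : IsTrajectory G f A b x)
    {p : EuclideanSpace ℝ (Fin n)} (hp : ∀ i, Matrix.toEuclideanLin (A i) p = b i)
    {w₀ : Stacked ι n} (hw₀ : projLaplacian A G w₀ = stackedProj A (stackedGradient f p)) :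
    ∃ w, IsDampedTrajectory (projLaplacian A G) (projGradientGap f A p) (trackingError x p) w ∧
      ∀ t, 0 ≤ t → projLaplacian A G (w t) =
        stackedProj A (stackedIntegral G x t + stackedGradient f p) := by
  have hU := fun t ht => hx.stackedProj_trackingError hp (t := t) ht
  have hUc : ContinuousOn (trackingError x p) (Set.Ici 0) := fun t ht =>
    (hx.hasDerivWithinAt_trackingError p ht).continuousWithinAt
  have hw : ∀ t, 0 ≤ t → HasDerivWithinAt
      (fun t => w₀ + ∫ s in (0 : ℝ)..t, trackingError x p s) (trackingError x p t)
      (Set.Ici 0) t := fun t ht => (hasDerivWithinAt_integral_Ici hUc ht).const_add w₀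
  have hforce : ∀ t, 0 ≤ t →
      projLaplacian A G (w₀ + ∫ s in (0 : ℝ)..t, trackingError x p s) =
        stackedProj A (stackedIntegral G x t + stackedGradient f p) := by
    intro t ht
    -- Both sides have derivative `P L u`, because `P u = u`, and they agree at time `0` by the
    -- choice of `w₀`.
    have h1 := eq_of_hasDerivWithinAt_zero
      (φ := fun t => projLaplacian A G (w₀ + ∫ s in (0 : ℝ)..t, trackingError x p s) -
        stackedProj A (stackedIntegral G x t + stackedGradient f p)) (fun t ht => by
        refine (((projLaplacian A G).hasFDerivAt.comp_hasDerivWithinAt t (hw t ht)).sub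
          ((stackedProj A).hasFDerivAt.comp_hasDerivWithinAt t
            ((hx.hasDerivWithinAt_stackedIntegral p ht).add_const _))).congr_deriv ?_
        rw [projLaplacian_apply, hU t ht, sub_self]) ht
    have h2 : stackedIntegral G x 0 = 0 := by
      refine Stacked.ext fun i => ?_
      simp [stackedIntegral, integralTerm]
    simp only [intervalIntegral.integral_same, add_zero, hw₀, h2, zero_add, sub_self] at h1
    exact sub_eq_zero.1 h1
  refine ⟨_, ⟨fun t ht => ?_, hw⟩, hforce⟩
  refine (hx.hasDerivWithinAt_trackingError p ht).congr_deriv ?_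
  rw [hforce t ht, projGradientGap, projLaplacian_apply, hU t ht, ← map_add, ← map_add]

/-- The equilibrium integral state is attained in the range of the compressed Laplacian. -/
theorem IsOptimal.exists_projLaplacian_eq (hG : G.Connected) (hd : ∀ i, Differentiable ℝ (f i))
    {p : EuclideanSpace ℝ (Fin n)} (hp : IsOptimal f A b fun _ => p) :
    ∃ w₀, projLaplacian A G w₀ = stackedProj A (stackedGradient f p) := by
  -- It suffices to test against `v` in the kernel: then `P v` is a consensus vector with value `a`
  -- in every `ker (A i)`, and the pairing is the first-order condition in direction `a`.
  refine exists_preimage_of_orthogonal_ker (projLaplacian_symmetric A G) fun v hv => ?_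
  obtain ⟨a, ha⟩ := exists_stackedProj_eq_consensus A hG hv
  have ha' := (stackedProj_consensus_eq_self_iff A).1
    (by rw [← ha, stackedProj_stackedProj] : stackedProj A (consensus ι a) = consensus ι a)
  rw [← stackedProj_symmetric, ha, real_inner_comm, inner_stacked]
  exact hp.sum_inner_gradient_eq_zero hd ha'

/-- Equilibria of the damped system correspond to optimal points. -/
theorem exists_isOptimal_of_equilibrium (hG : G.Connected)
    (hconv : ∀ i, ConvexOn ℝ Set.univ (f i)) (hd : ∀ i, Differentiable ℝ (f i))
    {p : EuclideanSpace ℝ (Fin n)} (hp : IsOptimal f A b fun _ => p) {u : Stacked ι n}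
    (hu : stackedProj A u = u) (hMu : projLaplacian A G u = 0) (hgu : projGradientGap f A p u = 0) :
    ∃ a, u = consensus ι a ∧ IsOptimal f A b fun _ => p + a := by
  obtain ⟨a, ha⟩ := exists_stackedProj_eq_consensus A hG hMu
  rw [hu] at ha
  subst ha
  have ha := (stackedProj_consensus_eq_self_iff A).1 hu
  have := hG.nonempty
  refine ⟨a, rfl, isOptimal_of_sum_inner_gradient_eq_zero hconv hd
    (fun i => by rw [map_add, ha i, add_zero, hp.1.1 i]) fun v hv => ?_⟩
  have h1 : inner ℝ (projGradientGap f A p (consensus ι a)) (consensus ι v) = 0 := by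
    rw [hgu, inner_zero_left]
  rw [projGradientGap, stackedProj_symmetric, hu, (stackedProj_consensus_eq_self_iff A).2 hv,
    inner_stacked] at h1
  simp only [gradientGap_apply, consensus_apply, inner_sub_left, Finset.sum_sub_distrib] at h1
  rw [hp.sum_inner_gradient_eq_zero hd hv, sub_zero] at h1
  exact h1

theorem exists_lipschitzWith_pi {X : Type*} [PseudoEMetricSpace X] {Y : ι → Type*}
    [∀ i, PseudoEMetricSpace (Y i)] {F : X → ∀ i, Y i}
    (h : ∀ i, ∃ K : NNReal, LipschitzWith K fun z => F z i) :
    ∃ K : NNReal, LipschitzWith K F := by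
  choose K hK using h
  refine ⟨∑ i, K i, fun z z' => edist_pi_le_iff.2 fun i => ?_⟩
  exact (hK i).weaken (Finset.single_le_sum (fun _ _ => bot_le) (Finset.mem_univ i)) z z'

theorem lipschitzWith_disagreement (G : SimpleGraph ι) [DecidableRel G.Adj] :
    ∃ K : NNReal, LipschitzWith K
      (disagreement G : (ι → EuclideanSpace ℝ (Fin n)) → ι → EuclideanSpace ℝ (Fin n)) :=
  ⟨_, (LinearMap.toContinuousLinearMap (disagreementMap G)).lipschitz⟩

/-- Every admissible initial state is the initial state of a trajectory. -/
theorem exists_isTrajectory (hLip : ∀ i, ∃ K : NNReal, LipschitzWith K (gradient (f i)))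
    {x₀ : ι → EuclideanSpace ℝ (Fin n)} (hx₀ : ∀ i, Matrix.toEuclideanLin (A i) (x₀ i) = b i) :
    ∃ x, IsTrajectory G f A b x ∧ x 0 = x₀ := by
  obtain ⟨KL, hKL⟩ := lipschitzWith_disagreement (n := n) G
  obtain ⟨Kv, hKv⟩ : ∃ K, LipschitzWith K
      fun z : (ι → EuclideanSpace ℝ (Fin n)) × (ι → EuclideanSpace ℝ (Fin n)) =>
        fun i => -(kerProj (A i) (gradient (f i) (z.1 i) + disagreement G z.1 i + z.2 i)) := by
    refine exists_lipschitzWith_pi fun i => ?_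
    obtain ⟨Kf, hKf⟩ := hLip i
    exact ⟨_, ((kerProj (A i)).lipschitz.comp
      (((hKf.comp ((LipschitzWith.eval i).comp LipschitzWith.prod_fst)).add
        ((LipschitzWith.eval i).comp (hKL.comp LipschitzWith.prod_fst))).add
          ((LipschitzWith.eval i).comp LipschitzWith.prod_snd))).neg⟩
  -- Carrying the integral as a second state starting at `0` makes the equation autonomous and
  -- Lipschitz.
  obtain ⟨X, hX0, hX⟩ := exists_solution_Ici (hKv.prodMk (hKL.comp LipschitzWith.prod_fst)) (x₀, 0)
  have hx := fun t ht => hasDerivWithinAt_pi.1 (hX t ht).fst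
  have hy := fun t ht => hasDerivWithinAt_pi.1 (hX t ht).snd
  have hint : ∀ i t, 0 ≤ t → integralTerm G (fun s => (X s).1) i t = (X t).2 i := by
    intro i t ht
    have hcont : ∀ i, ContinuousOn (fun s => (X s).1 i) (Set.Ici 0) := fun i s hs =>
      (hx s hs i).continuousWithinAt
    have h1 := eq_of_hasDerivWithinAt_zero
      (φ := fun t => integralTerm G (fun s => (X s).1) i t - (X t).2 i) (fun t ht => by
        refine ((hasDerivWithinAt_integral_Ici (φ := fun s => disagreement G (X s).1 i)
          (continuousOn_finsetSum _ fun j _ => (hcont i).sub (hcont j)) ht).sub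
            (hy t ht i)).congr_deriv ?_
        exact sub_self _) ht
    simp only [integralTerm, intervalIntegral.integral_same, hX0, Pi.zero_apply, sub_self] at h1
    exact sub_eq_zero.1 h1
  refine ⟨fun t => (X t).1, ⟨fun i => by simpa only [hX0] using hx₀ i, fun t ht i => ?_⟩,
    by simp only [hX0]⟩
  rw [hint i t ht]
  exact hx t ht i

theorem stateError_eq (x : ℝ → ι → EuclideanSpace ℝ (Fin n)) (p : EuclideanSpace ℝ (Fin n))
    (t : ℝ) : stateError G f A p x t = ∑ i, ‖trackingError x p t i‖ +
      ∑ i, ‖stackedProj A (stackedIntegral G x t + stackedGradient f p) i‖ :=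
  Finset.sum_add_distrib

/-- Strong convexity of the sum makes the dissipation coercive. -/
theorem StronglyConvexAt.exists_dissipation (hG : G.Connected)
    (hd : ∀ i, Differentiable ℝ (f i)) {c : ℝ} (hc : 0 < c) {p : EuclideanSpace ℝ (Fin n)}
    (hN : Cocoercive c (gradientGap f p)) (h : StronglyConvexAt (fun x => ∑ i, f i x) p) :
    ∃ α : ℝ, 0 < α ∧ ∀ u : Stacked ι n,
      α * ‖u‖ ^ 2 ≤ inner ℝ u (gradientGap f p u) + inner ℝ u (laplacian G u) := by
  obtain ⟨ω, hω, h⟩ := h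
  obtain ⟨C, hC, hCG⟩ := exists_consensus_norm_sub_sq_le (n := n) hG
  have := hG.nonempty
  have hcard : (0 : ℝ) < Fintype.card ι := by exact_mod_cast Fintype.card_pos
  have hgrad : ∀ y, gradient (fun x => ∑ i, f i x) y = ∑ i, gradient (f i) y := by
    intro y
    simp only [gradient]
    rw [fderiv_fun_sum fun i _ => hd i y, map_sum]
  -- The division by the number of agents compensates for `‖consensus ι a‖²` being that multiple of
  -- `‖a‖²`.
  refine exists_mul_norm_sq_le_dissipation hc hN (gradientGap_zero f p) hC
    (γ := ω / Fintype.card ι) (by positivity) fun u => ?_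
  obtain ⟨a, ha⟩ := hCG u
  refine ⟨consensus ι a, ha, ?_⟩
  have h1 := h a
  rw [hgrad, hgrad, ← Finset.sum_sub_distrib, inner_sum, add_comm a p] at h1
  rw [norm_sq_consensus, inner_stacked]
  refine le_trans (le_of_eq ?_) h1
  field_simp

end Trajectory

/-! ### Convergence and exponential rate -/

section Convergence

variable {ι : Type*} [Fintype ι] {n : ℕ} {k : ι → ℕ}
  {G : SimpleGraph ι} [DecidableRel G.Adj] {f : ι → EuclideanSpace ℝ (Fin n) → ℝ}
  {A : (i : ι) → Matrix (Fin (k i)) (Fin n) ℝ} {b : (i : ι) → EuclideanSpace ℝ (Fin (k i))}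

theorem Stacked.tendsto_apply {z : ℝ → Stacked ι n} {a : Stacked ι n}
    (h : Filter.Tendsto z Filter.atTop (nhds a)) (i : ι) :
    Filter.Tendsto (fun t => z t i) Filter.atTop (nhds (a i)) :=
  ((LinearMap.toContinuousLinearMap
    ((LinearMap.proj i : (ι → EuclideanSpace ℝ (Fin n)) →ₗ[ℝ] _) ∘ₗ unstackLinear)).continuous.tendsto a).comp h

/-- Along every trajectory all agents converge to a common optimal point. -/
theorem IsTrajectory.exists_tendsto (hG : G.Connected)
    (hconv : ∀ i, ConvexOn ℝ Set.univ (f i)) (hd : ∀ i, Differentiable ℝ (f i))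
    (hLip : ∀ i, ∃ K : NNReal, LipschitzWith K (gradient (f i)))
    (hopt : ∃ z, IsOptimal f A b z) {x : ℝ → ι → EuclideanSpace ℝ (Fin n)}
    (hx : IsTrajectory G f A b x) :
    ∃ p, IsOptimal f A b (fun _ => p) ∧
      ∀ i, Filter.Tendsto (fun t => x t i) Filter.atTop (nhds p) := by
  obtain ⟨z, hz⟩ := hopt
  obtain ⟨i₀⟩ := hG.nonempty
  have hzp : z = fun _ => z i₀ := funext fun i => hz.1.2 i i₀
  obtain ⟨p, hp⟩ : ∃ p, IsOptimal f A b fun _ => p := ⟨z i₀, hzp ▸ hz⟩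
  obtain ⟨c, hc, hN⟩ := exists_cocoercive_gradientGap hconv hd hLip
  obtain ⟨w₀, hw₀⟩ := hp.exists_projLaplacian_eq hG hd
  obtain ⟨w, hw, -⟩ := hx.exists_isDampedTrajectory hp.1.1 hw₀
  obtain ⟨u, hMu, hgu, hu⟩ := hw.exists_tendsto (projLaplacian_symmetric A G)
    (inner_projLaplacian_nonneg A G) hc (cocoercive_projGradientGap hc (hN p))
    (projGradientGap_zero f A p)
  have hPu : stackedProj A u = u := by
    refine tendsto_nhds_unique ((((stackedProj A).continuous.tendsto u).comp hu).congr' ?_) hu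
    filter_upwards [Filter.eventually_ge_atTop 0] with t ht
    exact hx.stackedProj_trackingError hp.1.1 ht
  obtain ⟨a, rfl, ha⟩ := exists_isOptimal_of_equilibrium hG hconv hd hp hPu hMu hgu
  refine ⟨p + a, ha, fun i => ?_⟩
  have h1 := (Stacked.tendsto_apply hu i).const_add p
  simpa [trackingError] using h1

/-- Under strong convexity of the sum at the optimal point, trajectories converge exponentially
with constants independent of the trajectory. -/
theorem IsOptimal.exists_stateError_le (hG : G.Connected)
    (hconv : ∀ i, ConvexOn ℝ Set.univ (f i)) (hd : ∀ i, Differentiable ℝ (f i))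
    (hLip : ∀ i, ∃ K : NNReal, LipschitzWith K (gradient (f i)))
    {p : EuclideanSpace ℝ (Fin n)} (hp : IsOptimal f A b fun _ => p)
    (hs : StronglyConvexAt (fun x => ∑ i, f i x) p) :
    ∃ C r : ℝ, 0 < C ∧ 0 < r ∧ ∀ x, IsTrajectory G f A b x → ∀ t : ℝ, 0 ≤ t →
      stateError G f A p x t ≤ C * stateError G f A p x 0 * Real.exp (-r * t) := by
  have := hG.nonempty
  have hcard : (0 : ℝ) < Fintype.card ι := by exact_mod_cast Fintype.card_pos
  obtain ⟨c, hc, hN⟩ := exists_cocoercive_gradientGap hconv hd hLip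
  obtain ⟨w₀, hw₀⟩ := hp.exists_projLaplacian_eq hG hd
  obtain ⟨α, hα, hαu⟩ := hs.exists_dissipation hG hd hc (hN p)
  obtain ⟨C, r, hC, hr, h⟩ := exists_exponential_decay (projLaplacian_symmetric A G)
    (inner_projLaplacian_nonneg A G) hc (cocoercive_projGradientGap (A := A) hc (hN p))
    (projGradientGap_zero f A p) hα
  refine ⟨Fintype.card ι * C, r, by positivity, hr, fun x hx t ht => ?_⟩
  obtain ⟨w, hw, hforce⟩ := hx.exists_isDampedTrajectory hp.1.1 hw₀
  -- The compressed operators are coercive only on vectors fixed by `P`, where their forms are those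
  -- of `gradientGap` and `laplacian`; hence coercivity is supplied along the trajectory.
  have h1 := h _ _ hw (fun t ht => by
    have hU := hx.stackedProj_trackingError hp.1.1 ht
    rw [inner_projLaplacian, projGradientGap, ← stackedProj_symmetric, hU]
    exact hαu _) t ht
  rw [hforce t ht, hforce 0 le_rfl] at h1
  rw [stateError_eq, stateError_eq]
  calc _ ≤ Fintype.card ι * ‖trackingError x p t‖ + Fintype.card ι *
        ‖stackedProj A (stackedIntegral G x t + stackedGradient f p)‖ :=
        add_le_add (sum_norm_le _) (sum_norm_le _)
    _ = Fintype.card ι * (‖trackingError x p t‖ +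
        ‖stackedProj A (stackedIntegral G x t + stackedGradient f p)‖) := (mul_add _ _ _).symm
    _ ≤ Fintype.card ι * (C * (‖trackingError x p 0‖ +
        ‖stackedProj A (stackedIntegral G x 0 + stackedGradient f p)‖) * Real.exp (-r * t)) := by
        gcongr
    _ ≤ Fintype.card ι * (C * (∑ i, ‖trackingError x p 0 i‖ +
        ∑ i, ‖stackedProj A (stackedIntegral G x 0 + stackedGradient f p) i‖) *
          Real.exp (-r * t)) := by
        gcongr <;> exact norm_le_sum_norm _
    _ = _ := by ring

end Convergence

end IntegralFeedback

theorem theorem1 {ι : Type*} [Fintype ι] {n : ℕ} {k : ι → ℕ}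
    (G : SimpleGraph ι) [DecidableRel G.Adj] (hG : G.Connected)
    (f : ι → EuclideanSpace ℝ (Fin n) → ℝ)
    (A : (i : ι) → Matrix (Fin (k i)) (Fin n) ℝ)
    (b : (i : ι) → EuclideanSpace ℝ (Fin (k i)))
    (hconv : ∀ i, ConvexOn ℝ Set.univ (f i))
    (hC1 : ∀ i, ContDiff ℝ 1 (f i))
    (hLip : ∀ i, ∃ K : NNReal, LipschitzWith K (gradient (f i)))
    (hopt : ∃ z, IntegralFeedback.IsOptimal f A b z) :
    -- every admissible initial state is the initial state of a trajectory
    (∀ x₀ : ι → EuclideanSpace ℝ (Fin n),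
      (∀ i, Matrix.toEuclideanLin (A i) (x₀ i) = b i) →
        ∃ x, IntegralFeedback.IsTrajectory G f A b x ∧ x 0 = x₀) ∧
    -- along every trajectory all agents converge to a common optimal point
    (∀ x, IntegralFeedback.IsTrajectory G f A b x →
      ∃ p : EuclideanSpace ℝ (Fin n), IntegralFeedback.IsOptimal f A b (fun _ => p) ∧
        ∀ i, Filter.Tendsto (fun t => x t i) Filter.atTop (nhds p)) ∧
    -- if the sum is strongly convex at the unique minimizer, convergence is globally exponential
    (∀ p : EuclideanSpace ℝ (Fin n), IntegralFeedback.IsOptimal f A b (fun _ => p) →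
      (∀ z, IntegralFeedback.IsOptimal f A b z → z = fun _ => p) →
      IntegralFeedback.StronglyConvexAt (fun x => ∑ i, f i x) p →
        ∃ C r : ℝ, 0 < C ∧ 0 < r ∧
          ∀ x, IntegralFeedback.IsTrajectory G f A b x → ∀ t : ℝ, 0 ≤ t →
            IntegralFeedback.stateError G f A p x t ≤
              C * IntegralFeedback.stateError G f A p x 0 * Real.exp (-r * t)) := by
  have hd : ∀ i, Differentiable ℝ (f i) := fun i => (hC1 i).differentiable one_ne_zero
  exact ⟨fun _ hx₀ => IntegralFeedback.exists_isTrajectory hLip hx₀,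
    fun _ hx => hx.exists_tendsto hG hconv hd hLip hopt,
    fun _ hp _ hs => hp.exists_stateError_le hG hconv hd hLip hs⟩
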